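/- Let $n\ge 3$. Let $\Gamma_n=\langle b_1,\dots,b_n \mid b_1^2=\dots=b_n^2=1\rangle$, and let $\Delta$ be its Cayley graph, an $n$-regular tree with vertex set $V(\Delta)=\Gamma_n$ in which $g$ and $gb_i$ are joined by an edge of colour $i$. For $v\in V(\Delta)$ and $I\subset\{1,\dots,n\}$ let $[v;I]$ be the connected component containing $v$ of the graph obtained from $\Delta$ by deleting all edges whose colour is not in $I$. Let $\mathcal X$ be the set of all such subtrees with $|I|=n-1$, and $\mathcal A$ the set of all such subtrees with $|I|=2$ (the alternating geodesics). For $v\in V(\Delta)$ write $X_i(v)=[v;\{1,\dots,n\}\setminus\{i\}]\in\mathcal X$. A Hurwitz map is a function $\phi:\mathcal X\to\mathbb C$ with $$\phi(X_i(v))+\phi(X_i(vb_i))=\prod_{j\ne i}\phi(X_j(v))\qquad\text{for all } v\in V(\Delta),\ 1\le i\le n.$$ It is extended to $\mathcal A$ and to $V(\Delta)$ by $$\phi([v;\{i,j\}])=\prod_{k\neq i,j}\phi(X_k(v)),\qquad \phi(v)=\prod_{k=1}^n\phi(X_k(v)).$$ For $\mu\in\mathbb C$, let $\mathcal B_\mu$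 be the set of Hurwitz maps $\phi$ such that $\sum_{i}\phi(X_i(v))^2-\prod_i\phi(X_i(v))=\mu$ for every $v\in V(\Delta)$, such that $\phi(\gamma)\notin[-2,2]$ for every $\gamma\in\mathcal A$, and such that $\{\gamma\in\mathcal A : |\phi(\gamma)|\le K\}$ is finite for some $K>2$. **Theorem.** Let $\mu\in\mathbb C$ and $\phi\in\mathcal B_\mu$. Then $$\sum_{\gamma\in\mathcal A}h(\phi(\gamma))-\sum_{v\in V(\Delta)}\frac{\mu}{\phi(v)}=1,\qquad h(z)=1-\sqrt{1-\frac{4}{z^2}},$$ where the square root is the one with non-negative real part and both infinite sums converge absolutely. In particular, when $\mu=0$, $$\sum_{\gamma\in\mathcal A}\left(1-\sqrt{1-\frac{4}{\phi(\gamma)^2}}\right)=1 .$$ -/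

import Mathlib

namespace MarkoffHurwitz

noncomputable section

/-! ### The group and its Cayley tree -/

/-- The relators `b_i ^ 2` of `Γ_n`. -/
def gammaRels (n : ℕ) : Set (FreeGroup (Fin n)) :=
  Set.range fun i : Fin n => FreeGroup.of i ^ 2

/-- `Γ_n = ⟨ b_1, …, b_n ∣ b_1 ^ 2 = ⋯ = b_n ^ 2 = 1 ⟩`. -/
abbrev Gamma (n : ℕ) : Type := PresentedGroup (gammaRels n)

/-- The generator `b_i` of `Γ_n`. -/
def gen {n : ℕ} (i : Fin n) : Gamma n := PresentedGroup.of i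

theorem gen_mul_gen {n : ℕ} (i : Fin n) : gen i * gen i = 1 := by
  have h : PresentedGroup.mk (gammaRels n) (FreeGroup.of i ^ 2) = 1 :=
    PresentedGroup.one_of_mem (Set.mem_range_self i)
  rw [map_pow, pow_two] at h
  exact h

theorem gen_ne_one {n : ℕ} (i : Fin n) : gen i ≠ 1 := by
  intro h
  have hr : ∀ r ∈ gammaRels n,
      FreeGroup.lift (fun _ : Fin n => Multiplicative.ofAdd (1 : ZMod 2)) r = 1 := by
    rintro r ⟨j, rfl⟩
    simp only [map_pow, FreeGroup.lift_apply_of]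
    decide
  have h2 := congrArg (PresentedGroup.toGroup hr) h
  have h3 := (PresentedGroup.toGroup.of hr).symm.trans (h2.trans (map_one _))
  exact absurd h3 (by decide)

/-- The graph with vertex set `V(Δ) = Γ_n` and with those edges of the Cayley graph `Δ` of `Γ_n`
whose colour lies in `I`, the `i`-edges being those between `g` and `g * b_i`.  It is the graph
obtained from `Δ` by deleting all the edges whose colour lies in the complement of `I`; for
`I = univ` it is the Cayley tree `Δ` itself. -/
def colourGraph (n : ℕ) (I : Finset (Fin n)) : SimpleGraph (Gamma n) where
  Adj g h := ∃ i ∈ I, h = g * gen i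
  symm := ⟨by
    rintro g h ⟨i, hi, rfl⟩
    exact ⟨i, hi, by rw [mul_assoc, gen_mul_gen, mul_one]⟩⟩
  loopless := ⟨by
    rintro g ⟨i, -, h⟩
    exact gen_ne_one i (mul_eq_left.mp h.symm)⟩

/-! ### Regular subtrees -/

/-- `T^{|k|}(Δ)`: the regularly labelled `k`-subtrees of `Δ`.  Such a subtree is given by a set `I`
of `k` colours and a connected component of `Δ` minus the edges with colour outside `I`. -/
def RegSubtree (n k : ℕ) : Type :=
  Σ I : {I : Finset (Fin n) // I.card = k}, (colourGraph n I.1).ConnectedComponent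

/-- `[v; I]`, the regular subtree with colour set `I` through the vertex `v`. -/
def regSubtree {n k : ℕ} (v : Gamma n) (I : Finset (Fin n)) (hI : I.card = k) : RegSubtree n k :=
  ⟨⟨I, hI⟩, (colourGraph n I).connectedComponentMk v⟩

/-- `𝒳 = T^{|n-1|}(Δ)`. -/
abbrev X (n : ℕ) : Type := RegSubtree n (n - 1)

/-- `𝒜 = T^{|2|}(Δ)`, the set of alternating geodesics of `Δ`. -/
abbrev A (n : ℕ) : Type := RegSubtree n 2

/-- `X_i = [v; [n] \ {i}]`, the element of `𝒳` through `v` that misses the colour `i`. -/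
def hatSubtree {n : ℕ} (v : Gamma n) (i : Fin n) : X n :=
  regSubtree v {i}ᶜ (by rw [Finset.card_compl, Finset.card_singleton, Fintype.card_fin])

theorem hatSubtree_mul_gen {n : ℕ} (v : Gamma n) {i j : Fin n} (hij : j ≠ i) :
    hatSubtree (v * gen j) i = hatSubtree v i := by
  have h : (colourGraph n {i}ᶜ).connectedComponentMk (v * gen j) =
      (colourGraph n {i}ᶜ).connectedComponentMk v := by
    refine (SimpleGraph.ConnectedComponent.eq.mpr (SimpleGraph.Adj.reachable ?_)).symm
    exact ⟨j, by simpa using hij, rfl⟩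
  exact congrArg (Sigma.mk (β := fun I : {I : Finset (Fin n) // I.card = n - 1} =>
    (colourGraph n I.1).ConnectedComponent) _) h

theorem hatSubtree_eq_of_walk {n : ℕ} {I : Finset (Fin n)} {v w : Gamma n}
    (p : (colourGraph n I).Walk v w) {i : Fin n} (hi : i ∉ I) :
    hatSubtree v i = hatSubtree w i := by
  induction p with
  | nil => rfl
  | cons h _ ih =>
    obtain ⟨j, hj, rfl⟩ := h
    rw [← ih, hatSubtree_mul_gen]
    rintro rfl
    exact hi hj

/-! ### Hurwitz maps -/

/-- A Hurwitz map `φ : 𝒳 → ℂ`: for every `i`-edge, with end points `v` and `v' = v * b_i`,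
`φ(X_i) + φ(X_i') = ∏_{j ≠ i} φ(X_j)`. -/
def IsHurwitzMap {n : ℕ} (φ : X n → ℂ) : Prop :=
  ∀ (v : Gamma n) (i : Fin n),
    φ (hatSubtree v i) + φ (hatSubtree (v * gen i) i) =
      ∏ j ∈ Finset.univ.erase i, φ (hatSubtree v j)

/-- A `μ`-Hurwitz map: a Hurwitz map that satisfies the vertex relation
`x_1 ^ 2 + ⋯ + x_n ^ 2 - x_1 ⋯ x_n = μ` at every vertex. -/
def IsMuHurwitzMap {n : ℕ} (μ : ℂ) (φ : X n → ℂ) : Prop :=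
  IsHurwitzMap φ ∧
    ∀ v : Gamma n, ∑ i, φ (hatSubtree v i) ^ 2 - ∏ i, φ (hatSubtree v i) = μ

/-- The extension of `φ : 𝒳 → ℂ` to the regular subtrees of `Δ`:
`φ([v; I]) = ∏_{i ∉ I} φ(X_i)`, where `X_i = [v; [n] \ {i}]`. -/
def extend {n k : ℕ} (φ : X n → ℂ) (T : RegSubtree n k) : ℂ :=
  T.2.lift (fun v => ∏ i ∈ T.1.1ᶜ, φ (hatSubtree v i)) (by
    intro v w p _
    refine Finset.prod_congr rfl fun i hi => ?_
    rw [hatSubtree_eq_of_walk p (Finset.mem_compl.mp hi)])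

/-- The extension of `φ` to the vertices, `V(Δ) = T^{|0|}(Δ)`: `φ(v) = ∏_i φ(X_i)`. -/
def vertexValue {n : ℕ} (φ : X n → ℂ) (v : Gamma n) : ℂ :=
  extend φ (regSubtree v ∅ Finset.card_empty)

/-! ### The Bowditch conditions -/

/-- `𝒜_φ(K)`. -/
def smallGeodesics {n : ℕ} (φ : X n → ℂ) (K : ℝ) : Set (A n) :=
  {γ | ‖extend φ γ‖ ≤ K}

/-- The Bowditch set `ℬ`: Hurwitz maps with `φ(γ) ∉ [-2, 2]` for all `γ ∈ 𝒜` and with `𝒜_φ(K)`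
finite for some `K > 2`. -/
def bowditchSet (n : ℕ) : Set (X n → ℂ) :=
  {φ | IsHurwitzMap φ ∧
    (∀ γ : A n, extend φ γ ∉ ((↑) : ℝ → ℂ) '' Set.Icc (-2) 2) ∧
    ∃ K : ℝ, 2 < K ∧ (smallGeodesics φ K).Finite}

/-- `ℬ_μ`, the set of `μ`-Hurwitz maps in `ℬ`. -/
def bowditchSetMu (n : ℕ) (μ : ℂ) : Set (X n → ℂ) :=
  {φ | φ ∈ bowditchSet n ∧ IsMuHurwitzMap μ φ}

/-- `h(z) = 1 - √(1 - 4 / z ^ 2)`, where the square root has non-negative real part. -/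
def h (z : ℂ) : ℂ := 1 - Complex.sqrt (1 - 4 / z ^ 2)

end

end MarkoffHurwitz

/-!
Orient the tree away from the vertex `1`. At a vertex `v` the ratios `r_i(v)` of `φ(X_i(v))` to
`∏_{j ≠ i} φ(X_j(v))` add up to `1 + μ / φ(v)`, and by the Hurwitz relation the two ratios of an
edge add up to `1`. Hence `r` is a flow with sources `μ / φ(v)`. The sums `s` of `h(φ(γ)) / 2` over
the geodesics `γ` through an edge form a flow whose source at `v` comes from the geodesics that
branch off at `v`. Both `r` and `s` are approximate roots of one quadratic equation, so the flux of
`r - s` through the sphere of radius `m` is at most a constant times the sum of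
`|∏_{j ≠ i} φ(X_j)|⁻²` over its edges. The Bowditch conditions make these products grow uniformly
along the edges far from `1`; the flux then tends to `0`, and the divergence theorem gives the
identity.
-/

namespace MarkoffHurwitz

noncomputable section

open Filter Topology
open Finset (univ powersetCard)

variable {n : ℕ}

/-! ### Lengths, outward colours and gates in the Cayley tree -/

theorem gen_inv (i : Fin n) : (gen i)⁻¹ = gen i :=
  inv_eq_of_mul_eq_one_left (gen_mul_gen i)

theorem mul_gen_mul_gen (v : Gamma n) (i : Fin n) : v * gen i * gen i = v := by
  rw [mul_assoc, gen_mul_gen, mul_one]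

theorem gamma_induction {p : Gamma n → Prop} (one : p 1)
    (mul_gen : ∀ v i, p v → p (v * gen i)) (v : Gamma n) : p v := by
  have hv : v ∈ Subgroup.closure (Set.range (gen (n := n))) := by
    rw [show gen (n := n) = PresentedGroup.of from rfl, PresentedGroup.closure_range_of]
    trivial
  induction hv using Subgroup.closure_induction_right with
  | one => exact one
  | mul_right x _ y hy ih =>
    obtain ⟨i, rfl⟩ := hy
    exact mul_gen x i ih
  | mul_inv_cancel x _ y hy ih =>
    obtain ⟨i, rfl⟩ := hy
    rw [gen_inv]
    exact mul_gen x i ih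

/-- Words in the colours without two equal adjacent letters: the normal forms of the elements of
`Γ_n`. The last letter comes first, so that multiplication by a generator acts on the head. -/
abbrev ReducedWord (n : ℕ) : Type := {w : List (Fin n) // w.IsChain (· ≠ ·)}

/-- Multiplication by `b_i` on reduced words. -/
def toggle (i : Fin n) (w : ReducedWord n) : ReducedWord n :=
  ⟨if w.1.head? = some i then w.1.tail else i :: w.1, by
    split_ifs with hi
    · exact w.2.tail
    · refine List.isChain_cons.mpr ⟨fun y hy hiy => hi ?_, w.2⟩
      rw [hiy]
      exact hy⟩

theorem toggle_involutive (i : Fin n) : Function.Involutive (toggle i) := by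
  rintro ⟨w, hw⟩
  cases w with
  | nil => simp [toggle]
  | cons j w =>
    by_cases hj : j = i
    · subst hj
      have hw' : w.head? ≠ some j := fun hh => (List.isChain_cons.mp hw).1 j hh rfl
      simp [toggle, hw']
    · simp [toggle, hj]

theorem togglePerm_rels :
    ∀ r ∈ gammaRels n, FreeGroup.lift (fun i => (toggle_involutive i).toPerm) r = 1 := by
  rintro _ ⟨i, rfl⟩
  rw [map_pow, FreeGroup.lift_apply_of, pow_two]
  exact Equiv.ext (toggle_involutive i)

/-- The normal form of an element of `Γ_n`, read off the action of `Γ_n` on reduced words. -/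
def reducedWord (v : Gamma n) : ReducedWord n :=
  PresentedGroup.toGroup togglePerm_rels v⁻¹ ⟨[], List.isChain_nil⟩

theorem reducedWord_one : (reducedWord (1 : Gamma n)).1 = [] := by
  simp [reducedWord]

theorem reducedWord_mul_gen (v : Gamma n) (i : Fin n) :
    reducedWord (v * gen i) = toggle i (reducedWord v) := by
  have hi : PresentedGroup.toGroup togglePerm_rels (gen i) = (toggle_involutive i).toPerm :=
    PresentedGroup.toGroup.of togglePerm_rels
  rw [reducedWord, mul_inv_rev, gen_inv, map_mul, hi]
  rfl

/-- The element of `Γ_n` spelled by a word, last letter first. -/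
def ofWord (w : List (Fin n)) : Gamma n := w.foldr (fun i v => v * gen i) 1

theorem ofWord_toggle (i : Fin n) (w : ReducedWord n) :
    ofWord (toggle i w).1 = ofWord w.1 * gen i := by
  obtain ⟨w, hw⟩ := w
  cases w with
  | nil => simp [toggle, ofWord]
  | cons j w =>
    by_cases hj : j = i
    · subst hj
      simp [toggle, ofWord, mul_gen_mul_gen]
    · simp [toggle, ofWord, hj]

theorem ofWord_reducedWord (v : Gamma n) : ofWord (reducedWord v).1 = v := by
  induction v using gamma_induction with
  | one => rw [reducedWord_one]; rfl
  | mul_gen v i ih => rw [reducedWord_mul_gen, ofWord_toggle, ih]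

theorem reducedWord_injective :
    Function.Injective fun v : Gamma n => (reducedWord v).1 :=
  Function.LeftInverse.injective ofWord_reducedWord

/-- The distance from `1` to `v` in the Cayley tree. -/
def len (v : Gamma n) : ℕ := (reducedWord v).1.length

/-- The colours of the edges at `v` that lead away from `1`. -/
def outward (v : Gamma n) : Finset (Fin n) := {i | (reducedWord v).1.head? ≠ some i}

theorem mem_outward {v : Gamma n} {i : Fin n} :
    i ∈ outward v ↔ (reducedWord v).1.head? ≠ some i := by
  simp [outward]

theorem outward_one : outward (1 : Gamma n) = univ := by
  simp [outward, reducedWord_one]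

theorem len_one : len (1 : Gamma n) = 0 := by
  rw [len, reducedWord_one, List.length_nil]

theorem reducedWord_mul_gen_of_mem {v : Gamma n} {i : Fin n} (hi : i ∈ outward v) :
    (reducedWord (v * gen i)).1 = i :: (reducedWord v).1 := by
  rw [reducedWord_mul_gen]
  exact if_neg (mem_outward.mp hi)

theorem len_mul_gen {v : Gamma n} {i : Fin n} (hi : i ∈ outward v) :
    len (v * gen i) = len v + 1 := by
  rw [len, reducedWord_mul_gen_of_mem hi, List.length_cons, len]

theorem outward_mul_gen {v : Gamma n} {i : Fin n} (hi : i ∈ outward v) :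
    outward (v * gen i) = univ.erase i := by
  ext j
  simp [mem_outward, reducedWord_mul_gen_of_mem hi, eq_comm]

theorem mem_outward_mul_gen {v : Gamma n} {i : Fin n} (hi : i ∉ outward v) :
    i ∈ outward (v * gen i) := by
  have hhead : (reducedWord v).1.head? = some i := by simpa [mem_outward] using hi
  have hchain := (reducedWord v).2
  have htoggle : (reducedWord (v * gen i)).1 = (reducedWord v).1.tail := by
    rw [reducedWord_mul_gen]
    exact if_pos hhead
  obtain ⟨w, hw⟩ : ∃ w, (reducedWord v).1 = i :: w := by
    simpa [List.head?_eq_some_iff] using hhead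
  rw [hw] at hchain
  rw [mem_outward, htoggle, hw]
  exact fun hi' => (List.isChain_cons.mp hchain).1 i hi' rfl

theorem exists_eq_mul_gen {v : Gamma n} (hv : len v ≠ 0) :
    ∃ u, ∃ i ∈ outward u, v = u * gen i := by
  obtain ⟨i, w, hw⟩ := List.exists_cons_of_length_pos (Nat.pos_of_ne_zero hv)
  have hi : i ∉ outward v := by simp [mem_outward, hw]
  exact ⟨v * gen i, i, mem_outward_mul_gen hi, (mul_gen_mul_gen v i).symm⟩

theorem eq_one_of_len_eq_zero {v : Gamma n} (hv : len v = 0) : v = 1 := by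
  apply reducedWord_injective
  simp only [reducedWord_one]
  exact List.eq_nil_of_length_eq_zero hv

theorem len_induction {p : Gamma n → Prop} (one : p 1)
    (mul_gen : ∀ v, ∀ i ∈ outward v, p v → p (v * gen i)) (v : Gamma n) : p v := by
  induction hm : len v generalizing v with
  | zero => exact eq_one_of_len_eq_zero hm ▸ one
  | succ m ih =>
    obtain ⟨u, i, hi, rfl⟩ := exists_eq_mul_gen (hm.trans_ne m.succ_ne_zero)
    rw [len_mul_gen hi, Nat.succ_inj] at hm
    exact mul_gen u i hi (ih u hm)

theorem finite_len_lt (n m : ℕ) : {v : Gamma n | len v < m}.Finite :=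
  (List.finite_length_lt (Fin n) m).preimage reducedWord_injective.injOn

theorem finite_len_eq (n m : ℕ) : {v : Gamma n | len v = m}.Finite :=
  (List.finite_length_eq (Fin n) m).preimage reducedWord_injective.injOn

/-- The vertices at distance less than `m` from `1`. -/
def ball (n m : ℕ) : Finset (Gamma n) := (finite_len_lt n m).toFinset

/-- The vertices at distance `m` from `1`. -/
def sphere (n m : ℕ) : Finset (Gamma n) := (finite_len_eq n m).toFinset

theorem mem_ball {m : ℕ} {v : Gamma n} : v ∈ ball n m ↔ len v < m := by simp [ball]

theorem mem_sphere {m : ℕ} {v : Gamma n} : v ∈ sphere n m ↔ len v = m := by simp [sphere]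

theorem sphere_zero : sphere n 0 = {1} := by
  ext v
  rw [mem_sphere, Finset.mem_singleton]
  exact ⟨eq_one_of_len_eq_zero, fun hv => hv ▸ len_one⟩

theorem sum_sphere_succ {M : Type*} [AddCommMonoid M] (m : ℕ) (f : Gamma n → M) :
    ∑ v ∈ sphere n (m + 1), f v = ∑ v ∈ sphere n m, ∑ i ∈ outward v, f (v * gen i) := by
  rw [Finset.sum_sigma' (sphere n m) outward fun v i => f (v * gen i)]
  symm
  refine Finset.sum_nbij (fun p => p.1 * gen p.2) ?_ ?_ ?_ fun _ _ => rfl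
  · rintro ⟨v, i⟩ hp
    rw [Finset.mem_sigma, mem_sphere] at hp
    rw [mem_sphere, len_mul_gen hp.2, hp.1]
  · rintro ⟨v, i⟩ hp ⟨w, j⟩ hq (hvw : v * gen i = w * gen j)
    simp only [Finset.coe_sigma, Set.mem_sigma_iff, Finset.mem_coe] at hp hq
    have hij : i = j := by
      have hi : i ∉ outward (v * gen i) := by simp [outward_mul_gen hp.2]
      rw [hvw, outward_mul_gen hq.2] at hi
      simpa using hi
    subst hij
    rw [mul_right_cancel hvw]
  · intro v hv
    rw [Finset.mem_coe, mem_sphere] at hv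
    obtain ⟨u, i, hi, rfl⟩ := exists_eq_mul_gen (hv.trans_ne m.succ_ne_zero)
    rw [len_mul_gen hi, Nat.succ_inj] at hv
    exact ⟨⟨u, i⟩, by simp [mem_sphere, hv, hi], rfl⟩

theorem sum_ball_succ {M : Type*} [AddCommMonoid M] (m : ℕ) (f : Gamma n → M) :
    ∑ v ∈ ball n (m + 1), f v = ∑ v ∈ ball n m, f v + ∑ v ∈ sphere n m, f v := by
  have hdisj : Disjoint (ball n m) (sphere n m) :=
    Finset.disjoint_left.mpr fun v hv hv' => by rw [mem_ball] at hv; rw [mem_sphere] at hv'; omega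
  rw [← Finset.sum_disjUnion hdisj]
  congr 1
  ext v
  rw [Finset.mem_disjUnion, mem_ball, mem_ball, mem_sphere]
  omega

theorem tendsto_ball (n : ℕ) : Tendsto (ball n) atTop atTop :=
  tendsto_atTop_finset_of_monotone
    (fun _ _ hab _ hv => mem_ball.mpr ((mem_ball.mp hv).trans_le hab))
    fun v => ⟨len v + 1, mem_ball.mpr (Nat.lt_succ_self _)⟩

/-- The normal form of the vertex of `[v; I]` nearest to `1`. -/
def gateWord (I : Finset (Fin n)) (v : Gamma n) : List (Fin n) :=
  (reducedWord v).1.dropWhile (· ∈ I)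

theorem gateWord_mul_gen {I : Finset (Fin n)} {i : Fin n} (hi : i ∈ I) (v : Gamma n) :
    gateWord I (v * gen i) = gateWord I v := by
  have haux : ∀ u : Gamma n, i ∈ outward u → gateWord I (u * gen i) = gateWord I u := by
    intro u hu
    rw [gateWord, reducedWord_mul_gen_of_mem hu, List.dropWhile_cons_of_pos (by simpa using hi),
      gateWord]
  by_cases hv : i ∈ outward v
  · exact haux v hv
  · have := haux _ (mem_outward_mul_gen hv)
    rw [mul_gen_mul_gen] at this
    exact this.symm

theorem gateWord_eq_of_reachable {I : Finset (Fin n)} {v w : Gamma n}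
    (hvw : (colourGraph n I).Reachable v w) : gateWord I v = gateWord I w := by
  obtain ⟨p⟩ := hvw
  induction p with
  | nil => rfl
  | cons hadj _ ih =>
    obtain ⟨i, hi, rfl⟩ := hadj
    rw [← ih, gateWord_mul_gen hi]

theorem gateWord_of_subset {I : Finset (Fin n)} {v : Gamma n} (hI : I ⊆ outward v) :
    gateWord I v = (reducedWord v).1 := by
  rw [gateWord]
  cases hw : (reducedWord v).1 with
  | nil => rfl
  | cons i w =>
    refine List.dropWhile_cons_of_neg fun hi => ?_
    have := hI (by simpa using hi)
    simp [mem_outward, hw] at this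

theorem exists_reachable_subset_outward (I : Finset (Fin n)) (v : Gamma n) :
    ∃ g, I ⊆ outward g ∧ (colourGraph n I).Reachable g v := by
  induction v using len_induction with
  | one => exact ⟨1, by simp [outward_one], SimpleGraph.Reachable.refl 1⟩
  | mul_gen v i hi ih =>
    by_cases hiI : i ∈ I
    · obtain ⟨g, hg, hgv⟩ := ih
      exact ⟨g, hg, hgv.trans (SimpleGraph.Adj.reachable ⟨i, hiI, rfl⟩)⟩
    · refine ⟨v * gen i, fun j hj => ?_, SimpleGraph.Reachable.refl _⟩
      rw [outward_mul_gen hi]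
      exact Finset.mem_erase.mpr ⟨fun hji => hiI (hji ▸ hj), Finset.mem_univ j⟩

/-- A regular subtree is determined by its vertex nearest to `1` and its colours, which all point
outward there. -/
def gateEquiv (n k : ℕ) :
    (Σ v : Gamma n, {I // I ∈ powersetCard k (outward v)}) ≃ RegSubtree n k :=
  Equiv.ofBijective (fun p => regSubtree p.1 p.2.1 (Finset.mem_powersetCard.mp p.2.2).2) <| by
    constructor
    · rintro ⟨v, I, hI⟩ ⟨w, J, hJ⟩ hvw
      obtain ⟨hIJ, hcomp⟩ := Sigma.mk.inj hvw
      obtain rfl : I = J := congrArg Subtype.val hIJ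
      have hreach := SimpleGraph.ConnectedComponent.exact (eq_of_heq hcomp)
      have hword : (reducedWord v).1 = (reducedWord w).1 := by
        rw [← gateWord_of_subset (Finset.mem_powersetCard.mp hI).1,
          ← gateWord_of_subset (Finset.mem_powersetCard.mp hJ).1, gateWord_eq_of_reachable hreach]
      obtain rfl := reducedWord_injective hword
      rfl
    · rintro ⟨⟨I, hI⟩, c⟩
      induction c using SimpleGraph.ConnectedComponent.ind with | _ v => ?_
      obtain ⟨g, hg, hgv⟩ := exists_reachable_subset_outward I v
      refine ⟨⟨g, I, Finset.mem_powersetCard.mpr ⟨hg, hI⟩⟩, ?_⟩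
      exact congrArg (Sigma.mk (β := fun J : {J : Finset (Fin n) // J.card = k} =>
        (colourGraph n J.1).ConnectedComponent) ⟨I, hI⟩)
        (SimpleGraph.ConnectedComponent.sound hgv)

/-! ### Sums over the outward edges of the tree -/

theorem eventually_cofinite_iff {p : Gamma n → Prop} :
    (∀ᶠ v in cofinite, p v) ↔ ∃ L, ∀ v, L ≤ len v → p v := by
  rw [eventually_cofinite]
  constructor
  · intro hfin
    obtain ⟨L, hL⟩ := (hfin.image len).bddAbove
    refine ⟨L + 1, fun v hv => ?_⟩
    by_contra hpv
    have := hL (Set.mem_image_of_mem len hpv)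
    omega
  · rintro ⟨L, hL⟩
    exact (finite_len_lt n L).subset fun v hv => not_le.mp fun hle => hv (hL v hle)

theorem eventually_sphere {p : Gamma n → Prop} (hp : ∀ᶠ v in cofinite, p v) :
    ∀ᶠ m in atTop, ∀ v ∈ sphere n m, p v := by
  obtain ⟨L, hL⟩ := eventually_cofinite_iff.mp hp
  filter_upwards [eventually_ge_atTop L] with m hm v hv
  exact hL v (mem_sphere.mp hv ▸ hm)

theorem eventually_mul_gen {p : Gamma n → Prop} (hp : ∀ᶠ v in cofinite, p v) :
    ∀ᶠ v in cofinite, ∀ i, p (v * gen i) :=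
  eventually_all.mpr fun i => (mul_left_injective (gen i)).tendsto_cofinite.eventually hp

/-- The sum of `f` over the edges that lead from the sphere of radius `m` to the next one. -/
def edgeSum {M : Type*} [AddCommMonoid M] (f : Gamma n → Fin n → M) (m : ℕ) : M :=
  ∑ v ∈ sphere n m, ∑ i ∈ outward v, f v i

theorem edgeSum_succ {M : Type*} [AddCommMonoid M] (f : Gamma n → Fin n → M) (m : ℕ) :
    edgeSum f (m + 1) =
      ∑ v ∈ sphere n m, ∑ i ∈ outward v, ∑ j ∈ univ.erase i, f (v * gen i) j := by
  rw [edgeSum, sum_sphere_succ]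
  exact Finset.sum_congr rfl fun v _ => Finset.sum_congr rfl fun i hi => by
    rw [outward_mul_gen hi]

theorem summable_edgeSum {f : Gamma n → Fin n → ℝ} (hf : ∀ v i, 0 ≤ f v i) {ρ : ℝ} (hρ : ρ < 1)
    (hcontr : ∀ᶠ v in cofinite, ∀ i ∈ outward v,
      ∑ j ∈ univ.erase i, f (v * gen i) j ≤ ρ * f v i) :
    Summable (edgeSum f) := by
  have hnonneg (m : ℕ) : 0 ≤ edgeSum f m :=
    Finset.sum_nonneg fun v _ => Finset.sum_nonneg fun i _ => hf v i
  refine summable_of_ratio_norm_eventually_le hρ ?_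
  filter_upwards [eventually_sphere hcontr] with m hm
  rw [Real.norm_of_nonneg (hnonneg _), Real.norm_of_nonneg (hnonneg _), edgeSum_succ, edgeSum,
    Finset.mul_sum]
  refine Finset.sum_le_sum fun v hv => ?_
  rw [Finset.mul_sum]
  exact Finset.sum_le_sum fun i hi => hm v hv i hi

theorem tendsto_edgeSum_zero {f : Gamma n → Fin n → ℝ} (hf : Summable (edgeSum f))
    {E : Type*} [NormedAddCommGroup E] {F : Gamma n → Fin n → E} {C : ℝ}
    (hF : ∀ᶠ v in cofinite, ∀ i ∈ outward v, ‖F v i‖ ≤ C * f v i) :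
    Tendsto (edgeSum F) atTop (𝓝 0) := by
  refine squeeze_zero_norm' (a := fun m => C * edgeSum f m) ?_ ?_
  · filter_upwards [eventually_sphere hF] with m hm
    simp only [edgeSum, Finset.mul_sum]
    exact norm_sum_le_of_le _ fun v hv => norm_sum_le_of_le _ fun i hi => hm v hv i hi
  · simpa using hf.tendsto_atTop_zero.const_mul C

theorem sum_ball_eq_sum_range {M : Type*} [AddCommMonoid M] (g : Gamma n → M) (m : ℕ) :
    ∑ v ∈ ball n m, g v = ∑ k ∈ Finset.range m, ∑ v ∈ sphere n k, g v := by
  induction m with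
  | zero => exact Finset.sum_eq_zero fun v hv => absurd (mem_ball.mp hv) (Nat.not_lt_zero _)
  | succ m ih => rw [sum_ball_succ, Finset.sum_range_succ, ih]

theorem summable_of_le_edge {f : Gamma n → Fin n → ℝ} (hf : Summable (edgeSum f))
    {g : Gamma n → ℝ} (hg : ∀ v, 0 ≤ g v) {C : ℝ}
    (hgf : ∀ᶠ v in cofinite, ∀ i ∈ outward v, g (v * gen i) ≤ C * f v i) :
    Summable g := by
  have hsphere : Summable fun m => ∑ v ∈ sphere n m, g v := by
    rw [← summable_nat_add_iff 1]
    refine (hf.mul_left C).of_norm_bounded_eventually_nat ?_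
    filter_upwards [eventually_sphere hgf] with m hm
    rw [Real.norm_of_nonneg (Finset.sum_nonneg fun v _ => hg v), sum_sphere_succ, edgeSum,
      Finset.mul_sum]
    refine Finset.sum_le_sum fun v hv => ?_
    rw [Finset.mul_sum]
    exact Finset.sum_le_sum fun i hi => hm v hv i hi
  refine summable_of_sum_le hg (c := ∑' m, ∑ v ∈ sphere n m, g v) fun u => ?_
  obtain ⟨m, hm⟩ := ((tendsto_ball n).eventually_ge_atTop u).exists
  calc ∑ v ∈ u, g v
    _ ≤ ∑ v ∈ ball n m, g v := Finset.sum_le_sum_of_subset_of_nonneg hm fun v _ _ => hg v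
    _ = ∑ k ∈ Finset.range m, ∑ v ∈ sphere n k, g v := sum_ball_eq_sum_range g m
    _ ≤ ∑' k, ∑ v ∈ sphere n k, g v :=
        hsphere.sum_le_tsum _ fun k _ => Finset.sum_nonneg fun v _ => hg v

section Divergence

variable {F : Gamma n → Fin n → ℂ} {G : Gamma n → ℂ} {a : ℂ}

theorem edgeSum_eq_add_sum_ball (hone : ∑ i, F 1 i = a + G 1)
    (hstep : ∀ v, ∀ i ∈ outward v,
      ∑ j ∈ univ.erase i, F (v * gen i) j = F v i + G (v * gen i)) (m : ℕ) :
    edgeSum F m = a + ∑ v ∈ ball n (m + 1), G v := by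
  induction m with
  | zero =>
    rw [sum_ball_eq_sum_range, Finset.sum_range_one, edgeSum, sphere_zero, Finset.sum_singleton,
      Finset.sum_singleton, outward_one, hone]
  | succ m ih =>
    rw [edgeSum_succ, sum_ball_succ, sum_sphere_succ, ← add_assoc, ← ih, edgeSum,
      ← Finset.sum_add_distrib]
    refine Finset.sum_congr rfl fun v _ => ?_
    rw [← Finset.sum_add_distrib]
    exact Finset.sum_congr rfl (hstep v)

theorem add_tsum_eq_zero (hone : ∑ i, F 1 i = a + G 1)
    (hstep : ∀ v, ∀ i ∈ outward v,
      ∑ j ∈ univ.erase i, F (v * gen i) j = F v i + G (v * gen i))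
    (hF : Tendsto (edgeSum F) atTop (𝓝 0)) (hG : Summable G) : a + ∑' v, G v = 0 := by
  have hball : Tendsto (fun m => ∑ v ∈ ball n (m + 1), G v) atTop (𝓝 (∑' v, G v)) :=
    (hG.hasSum.comp (tendsto_ball n)).comp (tendsto_add_atTop_nat 1)
  refine tendsto_nhds_unique (hball.const_add a) (hF.congr fun m => ?_)
  exact edgeSum_eq_add_sum_ball hone hstep m

end Divergence

theorem sum_powersetCard_two_insert {ι M : Type*} [DecidableEq ι] [AddCommMonoid M]
    {s : Finset ι} {a : ι} (ha : a ∉ s) (F : Finset ι → M) :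
    ∑ I ∈ powersetCard 2 (insert a s), F I =
      ∑ I ∈ powersetCard 2 s, F I + ∑ j ∈ s, F {a, j} := by
  rw [Finset.powersetCard_succ_insert ha, Finset.sum_union]
  · rw [Finset.powersetCard_one, Finset.map_eq_image, Finset.image_image, Finset.sum_image]
    · rfl
    · intro j hj k _ hjk
      replace hjk : ({a, j} : Finset ι) = {a, k} := hjk
      have hmem : j ∈ ({a, k} : Finset ι) := hjk ▸ by simp
      have hja : j ≠ a := fun hja => ha (hja ▸ hj)
      simpa [hja] using hmem
  · refine Finset.disjoint_left.mpr fun I hI hI' => ?_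
    obtain ⟨J, -, rfl⟩ := Finset.mem_image.mp hI'
    exact ha ((Finset.mem_powersetCard.mp hI).1 (Finset.mem_insert_self a J))

theorem sum_sum_erase_pair {ι M : Type*} [DecidableEq ι] [AddCommMonoid M] (s : Finset ι)
    (F : Finset ι → M) :
    ∑ i ∈ s, ∑ j ∈ s.erase i, F {i, j} = 2 • ∑ I ∈ powersetCard 2 s, F I := by
  induction s using Finset.induction_on with
  | empty => simp [Finset.powersetCard_eq_empty.mpr (Finset.card_empty.trans_lt two_pos)]
  | insert a s ha ih =>
    have hinner : ∀ i ∈ s,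
        ∑ j ∈ (insert a s).erase i, F {i, j} = F {a, i} + ∑ j ∈ s.erase i, F {i, j} := by
      intro i hi
      have hai : a ≠ i := fun hai => ha (hai ▸ hi)
      rw [Finset.erase_insert_of_ne hai, Finset.sum_insert (by simp [ha]), Finset.pair_comm]
    rw [Finset.sum_insert ha, Finset.erase_insert ha, Finset.sum_congr rfl hinner,
      Finset.sum_add_distrib, ih, sum_powersetCard_two_insert ha]
    abel

/-! ### The function `h` and linear recurrences -/

/-- Half of `h`: the contribution to the identity of one end of a geodesic of value `z`. -/
def eta (z : ℂ) : ℂ := h z / 2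

theorem eta_mul_one_sub (z : ℂ) : eta z * (1 - eta z) = 1 / z ^ 2 := by
  have hsq : Complex.sqrt (1 - 4 / z ^ 2) ^ 2 = 1 - 4 / z ^ 2 := by
    simpa only [Complex.sqrt, Nat.cast_ofNat] using
      Complex.cpow_nat_inv_pow (1 - 4 / z ^ 2) two_ne_zero
  simp only [eta, h]
  linear_combination (-1 / 4) * hsq

theorem re_eta_le (z : ℂ) : (eta z).re ≤ 1 / 2 := by
  have hsqrt : 0 ≤ (Complex.sqrt (1 - 4 / z ^ 2)).re := by
    rw [Complex.sqrt, Complex.cpow_inv_two_re]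
    exact Real.sqrt_nonneg _
  simp only [eta, h, Complex.div_ofNat_re, Complex.sub_re, Complex.one_re]
  linarith

theorem norm_eta_le_norm_one_sub (z : ℂ) : ‖eta z‖ ≤ ‖1 - eta z‖ := by
  have hre := re_eta_le z
  rw [← sq_le_sq₀ (norm_nonneg _) (norm_nonneg _), Complex.sq_norm, Complex.sq_norm,
    Complex.normSq_apply, Complex.normSq_apply]
  simp only [Complex.sub_re, Complex.one_re, Complex.sub_im, Complex.one_im]
  nlinarith

theorem norm_eta_le (z : ℂ) : ‖eta z‖ ≤ 2 * (‖z‖ ^ 2)⁻¹ := by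
  have hhalf : 1 / 2 ≤ ‖1 - eta z‖ := by
    have hre : (1 - eta z).re = 1 - (eta z).re := by simp
    linarith [re_eta_le z, Complex.re_le_norm (1 - eta z)]
  have hprod : ‖eta z‖ * ‖1 - eta z‖ = (‖z‖ ^ 2)⁻¹ := by
    rw [← norm_mul, eta_mul_one_sub, norm_div, norm_one, norm_pow, one_div]
  nlinarith [norm_nonneg (eta z)]

theorem exists_one_lt_norm_add_inv_eq {z : ℂ} (hz : z ∉ ((↑) : ℝ → ℂ) '' Set.Icc (-2) 2) :
    ∃ l : ℂ, 1 < ‖l‖ ∧ l + l⁻¹ = z := by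
  obtain ⟨s, hs⟩ := IsAlgClosed.exists_pow_nat_eq (discrim 1 (-z) 1) (n := 2) two_pos
  obtain ⟨l, hl⟩ := exists_quadratic_eq_zero one_ne_zero ⟨s, by rw [← hs, pow_two]⟩
  have hl0 : l ≠ 0 := by
    rintro rfl
    simp at hl
  have hsum : l + l⁻¹ = z := by
    field_simp
    linear_combination hl
  rcases lt_trichotomy ‖l‖ 1 with hlt | heq | hgt
  · refine ⟨l⁻¹, ?_, by rw [inv_inv, add_comm, hsum]⟩
    rw [norm_inv]
    exact (one_lt_inv₀ (norm_pos_iff.mpr hl0)).mpr hlt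
  · rw [Complex.inv_eq_conj heq, Complex.add_conj] at hsum
    have hre := abs_le.mp (heq ▸ Complex.abs_re_le_norm l)
    exact absurd ⟨2 * l.re, ⟨by linarith, by linarith⟩, hsum⟩ hz
  · exact ⟨l, hgt, hsum⟩

theorem tendsto_ratio_of_recurrence {l : ℂ} (hl : 1 < ‖l‖) {y : ℕ → ℂ}
    (hy : ∀ m, y (m + 2) = (l + l⁻¹) * y (m + 1) - y m) {ε : ℝ} (hε : 0 < ε)
    (hlow : ∀ᶠ m in atTop, ε ≤ ‖y m‖) :
    Tendsto (fun m => y (m + 1) / y m) atTop (𝓝 l) := by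
  have hl0 : l ≠ 0 := norm_pos_iff.mp (one_pos.trans hl)
  -- the operator `S - l⁻¹` kills the sequence `(S - l) y`, where `S` is the shift
  have hdiff (m : ℕ) : y (m + 1) - l * y m = (y 1 - l * y 0) * l⁻¹ ^ m := by
    induction m with
    | zero => simp
    | succ m ih =>
      rw [pow_succ, ← mul_assoc, ← ih, hy]
      field_simp
      ring
  have hdecay : Tendsto (fun m => ‖y 1 - l * y 0‖ * ‖l⁻¹‖ ^ m / ε) atTop (𝓝 0) := by
    have hinv : ‖l⁻¹‖ < 1 := by
      rw [norm_inv]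
      exact inv_lt_one_of_one_lt₀ hl
    simpa using ((tendsto_pow_atTop_nhds_zero_of_lt_one (norm_nonneg _) hinv).const_mul
      ‖y 1 - l * y 0‖).div_const ε
  rw [tendsto_iff_norm_sub_tendsto_zero]
  refine squeeze_zero_norm' ?_ hdecay
  filter_upwards [hlow] with m hm
  have hym : y m ≠ 0 := norm_pos_iff.mp (hε.trans_le hm)
  rw [norm_norm, div_sub' hym, norm_div, mul_comm (y m), hdiff, norm_mul, norm_pow]
  gcongr

/-- The behaviour of a Hurwitz map far out along a geodesic of value `z`: `t` is the ratio of the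
new region at a vertex to the product of the regions along the edge that leads there. -/
structure IsExpanding (κ : ℝ) (z t : ℂ) : Prop where
  half : 1 / 2 ≤ ‖t‖
  growth : 1 + κ ≤ ‖t * z‖
  sep : κ ≤ ‖t - eta z‖

theorem eventually_isExpanding_of_recurrence {z : ℂ} (hz : z ∉ ((↑) : ℝ → ℂ) '' Set.Icc (-2) 2)
    {y : ℕ → ℂ} (hy : ∀ m, y (m + 2) = z * y (m + 1) - y m) {ε : ℝ} (hε : 0 < ε)
    (hlow : ∀ᶠ m in atTop, ε ≤ ‖y m‖) :
    ∀ᶠ κ in 𝓝[>] (0 : ℝ), ∀ᶠ m in atTop, IsExpanding κ z (y (m + 1) / y m / z) := by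
  have hz0 : z ≠ 0 := fun hz0 => hz ⟨0, by norm_num, by simp [hz0]⟩
  obtain ⟨l, hl, hlz⟩ := exists_one_lt_norm_add_inv_eq hz
  have hinv : ‖l⁻¹‖ < 1 := by
    rw [norm_inv]
    exact inv_lt_one_of_one_lt₀ hl
  have hhalf : 1 / 2 < ‖l / z‖ := by
    have := hlz ▸ norm_add_le l l⁻¹
    rw [norm_div, lt_div_iff₀ (norm_pos_iff.mpr hz0)]
    linarith
  have hsep : 0 < ‖l / z - eta z‖ := by
    refine norm_pos_iff.mpr (sub_ne_zero.mpr fun heta => ?_)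
    have hle := norm_eta_le_norm_one_sub z
    rw [← heta, one_sub_div hz0, show z - l = l⁻¹ by rw [← hlz]; ring, norm_div, norm_div,
      div_le_div_iff_of_pos_right (norm_pos_iff.mpr hz0)] at hle
    linarith
  have hlim : Tendsto (fun m => y (m + 1) / y m / z) atTop (𝓝 (l / z)) :=
    (tendsto_ratio_of_recurrence hl (hlz.symm ▸ hy) hε hlow).div_const z
  have hgrowth : Tendsto (fun m => ‖y (m + 1) / y m / z * z‖) atTop (𝓝 ‖l‖) := by
    simpa [hz0] using (hlim.mul_const z).norm
  filter_upwards [eventually_nhdsWithin_of_eventually_nhds (eventually_lt_nhds (sub_pos.mpr hl)),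
    eventually_nhdsWithin_of_eventually_nhds (eventually_lt_nhds hsep)] with κ hκl hκsep
  filter_upwards [hlim.norm.eventually_const_le hhalf,
    hgrowth.eventually_const_le (show 1 + κ < ‖l‖ by linarith),
    (hlim.sub_const (eta z)).norm.eventually_const_le hκsep] with m h₁ h₂ h₃
  exact ⟨h₁, h₂, h₃⟩

theorem eventually_isExpanding_of_lt_norm {K : ℝ} (hK : 2 < K) :
    ∀ᶠ κ in 𝓝[>] (0 : ℝ), ∀ z t : ℂ, K < ‖z‖ → 1 / 2 ≤ ‖t‖ → IsExpanding κ z t := by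
  have hsep : 0 < 1 / 2 - 2 * (K ^ 2)⁻¹ := by
    rw [sub_pos, ← div_eq_mul_inv, div_lt_div_iff₀ (by positivity) two_pos]
    nlinarith
  filter_upwards [eventually_nhdsWithin_of_eventually_nhds
      (eventually_lt_nhds (show 0 < K / 2 - 1 by linarith)),
    eventually_nhdsWithin_of_eventually_nhds (eventually_lt_nhds hsep)] with κ hκK hκsep z t hz ht
  refine ⟨ht, ?_, ?_⟩
  · rw [norm_mul]
    nlinarith [norm_nonneg z]
  · have heta : ‖eta z‖ ≤ 2 * (K ^ 2)⁻¹ := (norm_eta_le z).trans (by gcongr)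
    linarith [norm_sub_norm_le t (eta z)]

/-! ### Regions, edges and geodesics at a vertex -/

section LocalAlgebra

variable {φ : X n → ℂ}

/-- The product of the values of the regions that contain the `i`-edge at `v`. -/
def edgeValue (φ : X n → ℂ) (v : Gamma n) (i : Fin n) : ℂ :=
  ∏ j ∈ univ.erase i, φ (hatSubtree v j)

/-- The value of the alternating geodesic `[v; {i, j}]`. -/
def geodesicValue (φ : X n → ℂ) (v : Gamma n) (i j : Fin n) : ℂ :=
  ∏ k ∈ ({i, j} : Finset (Fin n))ᶜ, φ (hatSubtree v k)

/-- The share of `φ(X_i(v))` in the Hurwitz relation of the `i`-edge at `v`. -/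
def edgeRatio (φ : X n → ℂ) (v : Gamma n) (i : Fin n) : ℂ :=
  φ (hatSubtree v i) / edgeValue φ v i

theorem vertexValue_eq_prod (v : Gamma n) : vertexValue φ v = ∏ i, φ (hatSubtree v i) := by
  simp [vertexValue, extend, regSubtree]

theorem mul_edgeValue (v : Gamma n) (i : Fin n) :
    φ (hatSubtree v i) * edgeValue φ v i = vertexValue φ v := by
  rw [vertexValue_eq_prod]
  exact Finset.mul_prod_erase univ (fun j => φ (hatSubtree v j)) (Finset.mem_univ i)

theorem mul_geodesicValue (v : Gamma n) {i j : Fin n} (hij : i ≠ j) :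
    φ (hatSubtree v j) * geodesicValue φ v i j = edgeValue φ v i := by
  have hcompl : ({i, j} : Finset (Fin n))ᶜ = (univ.erase i).erase j := by
    ext k
    simp [and_comm]
  rw [geodesicValue, hcompl]
  exact Finset.mul_prod_erase _ (fun k => φ (hatSubtree v k)) (by simp [hij.symm])

theorem geodesicValue_comm (v : Gamma n) (i j : Fin n) :
    geodesicValue φ v i j = geodesicValue φ v j i := by
  rw [geodesicValue, Finset.pair_comm, geodesicValue]

theorem prod_hatSubtree_mul_gen (v : Gamma n) {i : Fin n} {s : Finset (Fin n)} (hi : i ∉ s) :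
    ∏ k ∈ s, φ (hatSubtree (v * gen i) k) = ∏ k ∈ s, φ (hatSubtree v k) :=
  Finset.prod_congr rfl fun k hk => by
    rw [hatSubtree_mul_gen v fun hik : i = k => hi (hik ▸ hk)]

theorem edgeValue_mul_gen (v : Gamma n) (i : Fin n) :
    edgeValue φ (v * gen i) i = edgeValue φ v i :=
  prod_hatSubtree_mul_gen v (Finset.notMem_erase i univ)

theorem geodesicValue_mul_gen (v : Gamma n) (i j : Fin n) :
    geodesicValue φ (v * gen i) i j = geodesicValue φ v i j :=
  prod_hatSubtree_mul_gen v (by simp)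

theorem edgeValue_mul_gen_of_ne (v : Gamma n) {i j : Fin n} (hij : i ≠ j) :
    edgeValue φ (v * gen i) j = φ (hatSubtree (v * gen i) i) * geodesicValue φ v i j := by
  rw [← mul_geodesicValue _ hij.symm, geodesicValue_comm, geodesicValue_mul_gen]

variable (h0 : ∀ v i, φ (hatSubtree v i) ≠ 0)
include h0

theorem edgeValue_ne_zero (v : Gamma n) (i : Fin n) : edgeValue φ v i ≠ 0 :=
  Finset.prod_ne_zero_iff.mpr fun j _ => h0 v j

theorem geodesicValue_ne_zero (v : Gamma n) (i j : Fin n) : geodesicValue φ v i j ≠ 0 :=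
  Finset.prod_ne_zero_iff.mpr fun k _ => h0 v k

theorem edgeRatio_ne_zero (v : Gamma n) (i : Fin n) : edgeRatio φ v i ≠ 0 :=
  div_ne_zero (h0 v i) (edgeValue_ne_zero h0 v i)

theorem edgeRatio_mul_edgeValue (v : Gamma n) (i : Fin n) :
    edgeRatio φ v i * edgeValue φ v i = φ (hatSubtree v i) :=
  div_mul_cancel₀ _ (edgeValue_ne_zero h0 v i)

theorem vertexValue_eq (v : Gamma n) (i : Fin n) :
    vertexValue φ v = edgeRatio φ v i * edgeValue φ v i ^ 2 := by
  rw [← mul_edgeValue v i, ← edgeRatio_mul_edgeValue h0]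
  ring

theorem edgeValue_child (v : Gamma n) {i j : Fin n} (hij : i ≠ j) :
    edgeValue φ (v * gen i) j =
      edgeRatio φ (v * gen i) i * edgeValue φ v i * geodesicValue φ v i j := by
  rw [edgeValue_mul_gen_of_ne v hij, ← edgeValue_mul_gen v i, edgeRatio_mul_edgeValue h0]

theorem edgeRatio_child (v : Gamma n) {i j : Fin n} (hij : i ≠ j) :
    edgeRatio φ (v * gen i) j =
      1 / (edgeRatio φ (v * gen i) i * geodesicValue φ v i j ^ 2) := by
  have hz := geodesicValue_ne_zero h0 v i j
  have ht := edgeRatio_ne_zero h0 (v * gen i) i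
  have hx := h0 v j
  rw [edgeRatio, edgeValue_child h0 v hij, ← mul_geodesicValue v hij, hatSubtree_mul_gen v hij]
  field_simp

theorem edgeRatio_add_edgeRatio (hH : IsHurwitzMap φ) (v : Gamma n) (i : Fin n) :
    edgeRatio φ v i + edgeRatio φ (v * gen i) i = 1 := by
  rw [edgeRatio, edgeRatio, edgeValue_mul_gen, ← add_div, hH v i]
  exact div_self (edgeValue_ne_zero h0 v i)

end LocalAlgebra

theorem exists_ne_ne (hn : 3 ≤ n) (i j : Fin n) : ∃ k, k ≠ i ∧ k ≠ j := by
  obtain ⟨k, hk⟩ := Finset.exists_mem_notMem_of_card_lt_card (s := {i, j}) (t := univ)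
    (Finset.card_le_two.trans_lt (by rwa [Finset.card_univ, Fintype.card_fin]))
  exact ⟨k, by simpa using hk⟩

section Bowditch

variable {φ : X n → ℂ}

theorem geodesicValue_eq_extend (v : Gamma n) {i j : Fin n} (hij : i ≠ j) :
    geodesicValue φ v i j = extend φ (regSubtree v {i, j} (Finset.card_pair hij)) :=
  rfl

theorem geodesicValue_notMem (hφ : φ ∈ bowditchSet n) (v : Gamma n) {i j : Fin n} (hij : i ≠ j) :
    geodesicValue φ v i j ∉ ((↑) : ℝ → ℂ) '' Set.Icc (-2) 2 :=
  geodesicValue_eq_extend v hij ▸ hφ.2.1 _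

theorem hatSubtree_ne_zero (hφ : φ ∈ bowditchSet n) (hn : 3 ≤ n) (v : Gamma n) (k : Fin n) :
    φ (hatSubtree v k) ≠ 0 := by
  intro hk
  obtain ⟨i, hik, -⟩ := exists_ne_ne hn k k
  obtain ⟨j, hji, hjk⟩ := exists_ne_ne hn i k
  refine geodesicValue_notMem hφ v hji ⟨0, by norm_num, ?_⟩
  rw [geodesicValue, Finset.prod_eq_zero (i := k) (by simp [hik.symm, hjk.symm]) hk]
  rfl

theorem eventually_lt_norm_geodesicValue {K : ℝ} (hfin : (smallGeodesics φ K).Finite) :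
    ∀ᶠ v in cofinite, ∀ i ∈ outward v, ∀ j ∈ outward v, i ≠ j → K < ‖geodesicValue φ v i j‖ := by
  refine (hfin.image fun γ => ((gateEquiv n 2).symm γ).1).subset fun v hv => ?_
  simp only [Set.mem_compl_iff, Set.mem_ofPred_eq, not_forall, not_lt] at hv
  obtain ⟨i, hi, j, hj, hij, hsmall⟩ := hv
  have hmem : {i, j} ∈ powersetCard 2 (outward v) :=
    Finset.mem_powersetCard.mpr ⟨by simp [Finset.insert_subset_iff, hi, hj], Finset.card_pair hij⟩
  exact ⟨gateEquiv n 2 ⟨v, {i, j}, hmem⟩, hsmall,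
    congrArg Sigma.fst ((gateEquiv n 2).symm_apply_apply _)⟩

end Bowditch

/-! ### Expansion along a single geodesic -/

/-- A step away from `1` along an alternating geodesic: the `i`-edge at `v` on `[v; {i, j}]`. -/
structure GeodesicStep (n : ℕ) where
  v : Gamma n
  i : Fin n
  j : Fin n
  ne : i ≠ j
  mem : i ∈ outward v

namespace GeodesicStep

/-- The following step along the same geodesic. -/
def next (s : GeodesicStep n) : GeodesicStep n where
  v := s.v * gen s.i
  i := s.j
  j := s.i
  ne := s.ne.symm
  mem := by simp [outward_mul_gen s.mem, s.ne.symm]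

theorem len_next_iterate (s : GeodesicStep n) (m : ℕ) : len (next^[m] s).v = len s.v + m := by
  induction m with
  | zero => rfl
  | succ m ih =>
    rw [Function.iterate_succ_apply', next, len_mul_gen (next^[m] s).mem, ih, add_assoc]

theorem exists_eq_next_iterate (s : GeodesicStep n) :
    ∃ (g : GeodesicStep n) (m : ℕ), g.j ∈ outward g.v ∧ s = next^[m] g := by
  induction hl : len s.v generalizing s with
  | zero =>
    refine ⟨s, 0, ?_, rfl⟩
    rw [eq_one_of_len_eq_zero hl, outward_one]
    exact Finset.mem_univ _
  | succ l ih =>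
    by_cases hj : s.j ∈ outward s.v
    · exact ⟨s, 0, hj, rfl⟩
    · let p : GeodesicStep n := ⟨s.v * gen s.j, s.j, s.i, s.ne.symm, mem_outward_mul_gen hj⟩
      have hp : p.next = s := by
        obtain ⟨v, i, j, _, _⟩ := s
        simp only [next, p, mul_gen_mul_gen]
      have hlen : len p.v = l := by
        have := len_mul_gen p.mem
        rw [show p.v * gen p.i = s.v from congrArg GeodesicStep.v hp] at this
        omega
      obtain ⟨g, m, hg, hpg⟩ := ih p hlen
      exact ⟨g, m + 1, hg, by rw [Function.iterate_succ_apply', ← hpg, hp]⟩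

theorem hatSubtree_next_iterate (g : GeodesicStep n) {k : Fin n} (hi : k ≠ g.i) (hj : k ≠ g.j)
    (m : ℕ) : k ≠ (next^[m] g).i ∧ k ≠ (next^[m] g).j ∧
      hatSubtree (next^[m] g).v k = hatSubtree g.v k := by
  induction m with
  | zero => exact ⟨hi, hj, rfl⟩
  | succ m ih =>
    rw [Function.iterate_succ_apply']
    exact ⟨ih.2.1, ih.1, (hatSubtree_mul_gen _ ih.1.symm).trans ih.2.2⟩

/-- The value of the geodesic that contains the step. -/
def value (φ : X n → ℂ) (s : GeodesicStep n) : ℂ := geodesicValue φ s.v s.i s.j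

/-- The ratio of the new region behind the step to the product of the regions along it. -/
def ratio (φ : X n → ℂ) (s : GeodesicStep n) : ℂ := edgeRatio φ (s.v * gen s.i) s.i

/-- The region next to the geodesic that the step leaves. -/
def region (φ : X n → ℂ) (s : GeodesicStep n) : ℂ := φ (hatSubtree s.v s.j)

variable {φ : X n → ℂ}

theorem value_next (s : GeodesicStep n) : s.next.value φ = s.value φ := by
  rw [value, next, geodesicValue_comm, geodesicValue_mul_gen, value]

theorem value_next_iterate (s : GeodesicStep n) (m : ℕ) :
    (next^[m] s).value φ = s.value φ := by
  induction m with
  | zero => rfl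
  | succ m ih => rw [Function.iterate_succ_apply', value_next, ih]

theorem region_next_next (hH : IsHurwitzMap φ) (s : GeodesicStep n) :
    s.next.next.region φ = s.value φ * s.next.region φ - s.region φ := by
  have hrel : s.next.region φ * s.value φ = edgeValue φ s.next.v s.next.i := by
    rw [← value_next]
    exact mul_geodesicValue _ s.next.ne
  have hkeep : s.region φ = φ (hatSubtree s.next.v s.next.i) :=
    congrArg φ (hatSubtree_mul_gen s.v s.ne).symm
  rw [mul_comm, hrel, hkeep, edgeValue, ← hH, add_sub_cancel_left]
  rfl

theorem ratio_eq (s : GeodesicStep n) :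
    s.ratio φ = s.next.region φ / s.region φ / s.value φ := by
  rw [ratio, edgeRatio, edgeValue_mul_gen, ← mul_geodesicValue s.v s.ne, div_div]
  rfl

variable {K : ℝ}

theorem exists_le_norm_region (hφ : φ ∈ bowditchSet n) (hn : 3 ≤ n) (hK : 0 < K)
    (hfin : (smallGeodesics φ K).Finite) (g : GeodesicStep n) :
    ∃ ε > 0, ∀ᶠ m in atTop, ε ≤ ‖(next^[m] g).region φ‖ := by
  have h0 := hatSubtree_ne_zero hφ hn
  obtain ⟨k, hki, hkj⟩ := exists_ne_ne hn g.i g.j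
  have hz : 0 < ‖g.value φ‖ := norm_pos_iff.mpr (geodesicValue_ne_zero h0 _ _ _)
  refine ⟨K * ‖φ (hatSubtree g.v k)‖ / ‖g.value φ‖,
    div_pos (mul_pos hK (norm_pos_iff.mpr (h0 _ _))) hz, ?_⟩
  obtain ⟨L, hL⟩ := eventually_cofinite_iff.mp (eventually_lt_norm_geodesicValue hfin)
  filter_upwards [eventually_gt_atTop L] with m hm
  obtain ⟨m, rfl⟩ := Nat.exists_eq_succ_of_ne_zero (Nat.ne_zero_of_lt hm)
  obtain ⟨hki', hkj', hk⟩ := hatSubtree_next_iterate g hki hkj (m + 1)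
  have hvalue := value_next_iterate (φ := φ) g (m + 1)
  have hlen := len_next_iterate g (m + 1)
  have hout : k ∈ outward (next^[m + 1] g).v := by
    rw [Function.iterate_succ_apply'] at hkj' ⊢
    rw [next, outward_mul_gen (next^[m] g).mem]
    exact Finset.mem_erase.mpr ⟨hkj', Finset.mem_univ k⟩
  generalize next^[m + 1] g = s at *
  have hlarge := hL s.v (by omega) s.i s.mem k hout hki'.symm
  -- the edge has the same value whichever geodesic through it is used to compute it
  have hedge : ‖s.region φ‖ * ‖s.value φ‖ =
      ‖φ (hatSubtree s.v k)‖ * ‖geodesicValue φ s.v s.i k‖ := by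
    rw [← norm_mul, ← norm_mul, mul_geodesicValue s.v hki'.symm]
    exact congrArg _ (mul_geodesicValue s.v s.ne)
  rw [← hvalue, ← hk, div_le_iff₀ (hvalue ▸ hz), hedge, mul_comm]
  gcongr

theorem eventually_isExpanding_next_iterate (hφ : φ ∈ bowditchSet n) (hn : 3 ≤ n) (hK : 0 < K)
    (hfin : (smallGeodesics φ K).Finite) (g : GeodesicStep n) :
    ∀ᶠ κ in 𝓝[>] (0 : ℝ), ∀ᶠ m in atTop,
      IsExpanding κ ((next^[m] g).value φ) ((next^[m] g).ratio φ) := by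
  obtain ⟨ε, hε, hlow⟩ := exists_le_norm_region hφ hn hK hfin g
  have hrec (m : ℕ) : (next^[m + 2] g).region φ =
      g.value φ * (next^[m + 1] g).region φ - (next^[m] g).region φ := by
    rw [← value_next_iterate g m, Function.iterate_succ_apply', Function.iterate_succ_apply',
      region_next_next hφ.1]
  have hratio (m : ℕ) : (next^[m] g).ratio φ =
      (next^[m + 1] g).region φ / (next^[m] g).region φ / g.value φ := by
    rw [ratio_eq, value_next_iterate, Function.iterate_succ_apply']
  simp only [value_next_iterate, hratio]
  exact eventually_isExpanding_of_recurrence (y := fun m => (next^[m] g).region φ)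
    (geodesicValue_notMem hφ g.v g.ne) hrec hε hlow

theorem finite_small_gates (hfin : (smallGeodesics φ K).Finite) :
    {g : GeodesicStep n | g.j ∈ outward g.v ∧ ‖g.value φ‖ ≤ K}.Finite := by
  have hbad := eventually_cofinite.mp (eventually_lt_norm_geodesicValue hfin)
  refine ((hbad.prod (Set.finite_univ (α := Fin n × Fin n))).preimage
    (f := fun g : GeodesicStep n => (g.v, g.i, g.j)) ?_).subset ?_
  · rintro ⟨v, i, j, _, _⟩ _ ⟨w, k, l, _, _⟩ _ heq
    simpa using heq
  · rintro g ⟨hj, hsmall⟩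
    exact ⟨fun hlarge => (hlarge g.i g.mem g.j hj g.ne).not_ge hsmall, Set.mem_univ _⟩

theorem eventually_isExpanding_of_small (hφ : φ ∈ bowditchSet n) (hn : 3 ≤ n) (hK : 0 < K)
    (hfin : (smallGeodesics φ K).Finite) :
    ∀ᶠ κ in 𝓝[>] (0 : ℝ), ∀ᶠ v in cofinite, ∀ s : GeodesicStep n,
      s.v = v → ‖s.value φ‖ ≤ K → IsExpanding κ (s.value φ) (s.ratio φ) := by
  have hgates := finite_small_gates hfin
  filter_upwards [(eventually_all_finite hgates).mpr fun g _ =>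
    eventually_isExpanding_next_iterate hφ hn hK hfin g] with κ hκ
  obtain ⟨N, hN⟩ := eventually_atTop.mp ((eventually_all_finite hgates).mpr hκ)
  obtain ⟨B, hB⟩ := (hgates.image fun g => len g.v).bddAbove
  refine eventually_cofinite_iff.mpr ⟨B + N, ?_⟩
  rintro _ hlen s rfl hsmall
  obtain ⟨g, m, hgj, rfl⟩ := exists_eq_next_iterate s
  rw [value_next_iterate] at hsmall
  have hgB : len g.v ≤ B := hB (Set.mem_image_of_mem _ ⟨hgj, hsmall⟩)
  rw [len_next_iterate] at hlen
  exact hN m (by omega) g ⟨hgj, hsmall⟩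

end GeodesicStep

/-! ### Expansion along all far edges -/

/-- Since `p` passes to parent edges, a far edge with `p` ends a long chain of such edges, along
which `E` contracts below its lower bound. -/
theorem eventually_not_of_contraction {p : Gamma n → Fin n → Prop} {E : Gamma n → Fin n → ℝ}
    {c q : ℝ} (hc : 0 < c) (hq₀ : 0 ≤ q) (hq : q < 1)
    (hlow : ∀ᶠ v in cofinite, ∀ i ∈ outward v, p v i → c ≤ E v i)
    (hstep : ∀ᶠ v in cofinite, ∀ i ∈ outward v, ∀ j, i ≠ j →
      p (v * gen i) j → p v i ∧ E (v * gen i) j ≤ q * E v i) :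
    ∀ᶠ v in cofinite, ∀ i ∈ outward v, ¬ p v i := by
  obtain ⟨L, hL⟩ := eventually_cofinite_iff.mp hstep
  obtain ⟨B, hB⟩ := ((sphere n L).finite_toSet.prod (Set.finite_univ (α := Fin n))).image
    (fun e => E e.1 e.2) |>.bddAbove
  have hdecay (m : ℕ) : ∀ v, len v = L + m → ∀ i ∈ outward v, p v i → E v i ≤ q ^ m * B := by
    induction m with
    | zero =>
      intro v hv i _ _
      rw [pow_zero, one_mul]
      exact hB ⟨(v, i), ⟨mem_sphere.mpr hv, Set.mem_univ i⟩, rfl⟩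
    | succ m ih =>
      intro v hv j hj hp
      obtain ⟨u, i, hi, rfl⟩ := exists_eq_mul_gen (v := v) (by omega)
      have hu : len u = L + m := by
        rw [len_mul_gen hi] at hv
        omega
      have hij : i ≠ j := by
        rintro rfl
        simp [outward_mul_gen hi] at hj
      obtain ⟨hpu, hE⟩ := hL u (by omega) i hi j hij hp
      calc E (u * gen i) j ≤ q * E u i := hE
        _ ≤ q * (q ^ m * B) := by gcongr; exact ih u hu i hi hpu
        _ = q ^ (m + 1) * B := by ring
  have hlim : Tendsto (fun m => q ^ m * B) atTop (𝓝 0) := by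
    simpa using (tendsto_pow_atTop_nhds_zero_of_lt_one hq₀ hq).mul_const B
  obtain ⟨N, hN⟩ := eventually_atTop.mp (hlim.eventually_lt_const hc)
  filter_upwards [hlow, eventually_cofinite_iff.mpr ⟨L + N, fun _ hv => hv⟩] with v hv hlen i hi hp
  have hle := hdecay (len v - L) v (by omega) i hi hp
  exact absurd (hN (len v - L) (by omega)) (not_lt.mpr ((hv i hi hp).trans hle))

section FarEdges

variable {φ : X n → ℂ} {K : ℝ}

theorem one_le_norm_edgeValue (hn : 3 ≤ n) {v : Gamma n} {i : Fin n}
    (hz : ∀ j, i ≠ j → 1 < ‖geodesicValue φ v i j‖) : 1 ≤ ‖edgeValue φ v i‖ := by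
  obtain ⟨j, hji, -⟩ := exists_ne_ne hn i i
  obtain ⟨k, hk, hxk⟩ : ∃ k ∈ ({i, j} : Finset (Fin n))ᶜ, 1 ≤ ‖φ (hatSubtree v k)‖ := by
    by_contra! hsmall
    have hle : ‖geodesicValue φ v i j‖ ≤ 1 := by
      rw [geodesicValue, norm_prod]
      exact Finset.prod_le_one (fun k _ => norm_nonneg _) fun k hk => (hsmall k hk).le
    exact (hz j hji.symm).not_ge hle
  have hik : i ≠ k := by
    rintro rfl
    simp at hk
  rw [← mul_geodesicValue v hik, norm_mul]
  exact one_le_mul_of_one_le_of_one_le hxk (hz k hik).le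

theorem half_le_norm_edgeRatio_child (hφ : φ ∈ bowditchSet n) (hn : 3 ≤ n) {v : Gamma n}
    {i j : Fin n} (hij : i ≠ j) (hz : 2 < ‖geodesicValue φ v i j‖)
    (ht : 1 / 2 ≤ ‖edgeRatio φ (v * gen i) i‖) :
    1 / 2 ≤ ‖edgeRatio φ (v * gen i * gen j) j‖ := by
  have h0 := hatSubtree_ne_zero hφ hn
  have hsum := edgeRatio_add_edgeRatio h0 hφ.1 (v * gen i) j
  have hchild : ‖edgeRatio φ (v * gen i) j‖ ≤ 1 / 2 := by
    rw [edgeRatio_child h0 v hij, norm_div, norm_one, norm_mul, norm_pow]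
    exact one_div_le_one_div_of_le two_pos (by nlinarith)
  have htri := norm_add_le (edgeRatio φ (v * gen i) j) (edgeRatio φ (v * gen i * gen j) j)
  rw [hsum, norm_one] at htri
  linarith

theorem half_lt_norm_edgeRatio (hφ : φ ∈ bowditchSet n) (hn : 3 ≤ n) {v : Gamma n} {i : Fin n}
    (hbad : ‖edgeRatio φ (v * gen i) i‖ < 1 / 2) : 1 / 2 < ‖edgeRatio φ v i‖ := by
  have htri := norm_add_le (edgeRatio φ v i) (edgeRatio φ (v * gen i) i)
  rw [edgeRatio_add_edgeRatio (hatSubtree_ne_zero hφ hn) hφ.1, norm_one] at htri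
  linarith

theorem norm_vertexValue_child_le (hφ : φ ∈ bowditchSet n) (hn : 3 ≤ n) {v : Gamma n}
    {i j : Fin n} (hij : i ≠ j) (hK : 0 < K) (hz : K ≤ ‖geodesicValue φ v i j‖)
    (hbad : ‖edgeRatio φ (v * gen i) i‖ < 1 / 2)
    (hbad_child : ‖edgeRatio φ (v * gen i * gen j) j‖ < 1 / 2) :
    ‖vertexValue φ (v * gen i)‖ ≤ 4 / K ^ 2 * ‖vertexValue φ v‖ := by
  have h0 := hatSubtree_ne_zero hφ hn
  have hr := half_lt_norm_edgeRatio hφ hn hbad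
  have hr_child := half_lt_norm_edgeRatio hφ hn hbad_child
  have ht : ‖edgeRatio φ (v * gen i) i‖ ≤ 2 / K ^ 2 := by
    have ht0 : 0 < ‖edgeRatio φ (v * gen i) i‖ := norm_pos_iff.mpr (edgeRatio_ne_zero h0 _ _)
    have hz0 : 0 < ‖geodesicValue φ v i j‖ := hK.trans_le hz
    rw [edgeRatio_child h0 v hij, norm_div, norm_one, norm_mul, norm_pow,
      one_div_lt_one_div two_pos (by positivity)] at hr_child
    rw [le_div_iff₀ (by positivity)]
    calc ‖edgeRatio φ (v * gen i) i‖ * K ^ 2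
      _ ≤ ‖edgeRatio φ (v * gen i) i‖ * ‖geodesicValue φ v i j‖ ^ 2 := by gcongr
      _ ≤ 2 := hr_child.le
  rw [vertexValue_eq h0 (v * gen i) i, vertexValue_eq h0 v i, edgeValue_mul_gen, norm_mul,
    norm_mul, ← mul_assoc]
  gcongr
  calc ‖edgeRatio φ (v * gen i) i‖ ≤ 4 / K ^ 2 * (1 / 2) := ht.trans_eq (by ring)
    _ ≤ 4 / K ^ 2 * ‖edgeRatio φ v i‖ := by gcongr

theorem eventually_half_le_norm_edgeRatio (hφ : φ ∈ bowditchSet n) (hn : 3 ≤ n) :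
    ∀ᶠ v in cofinite, ∀ i ∈ outward v, 1 / 2 ≤ ‖edgeRatio φ (v * gen i) i‖ := by
  obtain ⟨K, hK, hfin⟩ := hφ.2.2
  have h0 := hatSubtree_ne_zero hφ hn
  obtain ⟨κ, hκ⟩ := (GeodesicStep.eventually_isExpanding_of_small hφ hn (by linarith) hfin).exists
  have hlarge : ∀ᶠ v in cofinite, ∀ i ∈ outward v, ‖edgeRatio φ (v * gen i) i‖ < 1 / 2 →
      ∀ j, i ≠ j → K < ‖geodesicValue φ v i j‖ := by
    filter_upwards [hκ] with v hv i hi hbad j hij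
    by_contra! hsmall
    exact (hv ⟨v, i, j, hij, hi⟩ rfl hsmall).half.not_gt hbad
  simp only [← not_lt]
  refine eventually_not_of_contraction (E := fun v _ => ‖vertexValue φ v‖) (c := 1 / 2)
    (q := 4 / K ^ 2) (by norm_num) (by positivity) ?_ ?_ ?_
  · rw [div_lt_one (by positivity)]
    nlinarith
  · filter_upwards [hlarge] with v hv i hi hbad
    have hr := half_lt_norm_edgeRatio hφ hn hbad
    have hP := one_le_norm_edgeValue hn fun j hij => (by linarith : (1 : ℝ) < K).trans
      (hv i hi hbad j hij)
    rw [vertexValue_eq h0 v i, norm_mul, norm_pow]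
    nlinarith
  · filter_upwards [eventually_mul_gen hlarge] with v hv i hi j hij hbad_child
    have hz : K < ‖geodesicValue φ v i j‖ := by
      have := hv i j (by simp [outward_mul_gen hi, hij.symm]) hbad_child i hij.symm
      rwa [geodesicValue_comm, geodesicValue_mul_gen] at this
    have hbad : ‖edgeRatio φ (v * gen i) i‖ < 1 / 2 := by
      by_contra! hgood
      exact (half_le_norm_edgeRatio_child hφ hn hij (hK.trans hz) hgood).not_gt hbad_child
    exact ⟨hbad, norm_vertexValue_child_le hφ hn hij (by linarith) hz.le hbad hbad_child⟩

theorem exists_eventually_isExpanding (hφ : φ ∈ bowditchSet n) (hn : 3 ≤ n) :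
    ∃ κ > 0, ∀ᶠ v in cofinite, ∀ i ∈ outward v, ∀ j, i ≠ j →
      IsExpanding κ (geodesicValue φ v i j) (edgeRatio φ (v * gen i) i) := by
  obtain ⟨K, hK, hfin⟩ := hφ.2.2
  obtain ⟨κ, ⟨hsmall, hlarge⟩, hκ⟩ :=
    ((GeodesicStep.eventually_isExpanding_of_small hφ hn (by linarith) hfin).and
      (eventually_isExpanding_of_lt_norm hK)).and self_mem_nhdsWithin |>.exists
  refine ⟨κ, hκ, ?_⟩
  filter_upwards [hsmall, eventually_half_le_norm_edgeRatio hφ hn] with v hv hhalf i hi j hij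
  rcases le_or_gt ‖geodesicValue φ v i j‖ K with hz | hz
  · exact hv ⟨v, i, j, hij, hi⟩ rfl hz
  · exact hlarge _ _ hz (hhalf i hi)

theorem eventually_le_norm_edgeValue (hφ : φ ∈ bowditchSet n) (hn : 3 ≤ n) {M : ℝ} (hM : 0 < M) :
    ∀ᶠ v in cofinite, ∀ i ∈ outward v, M ≤ ‖edgeValue φ v i‖ := by
  have h0 := hatSubtree_ne_zero hφ hn
  obtain ⟨κ, hκ, hexp⟩ := exists_eventually_isExpanding hφ hn
  have hP (v i) : 0 < ‖edgeValue φ v i‖ := norm_pos_iff.mpr (edgeValue_ne_zero h0 v i)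
  simp only [← not_lt]
  refine eventually_not_of_contraction (E := fun v i => ‖edgeValue φ v i‖⁻¹) (c := M⁻¹)
    (q := (1 + κ)⁻¹) (inv_pos.mpr hM) (by positivity) (inv_lt_one_of_one_lt₀ (by linarith))
    (.of_forall fun v i _ hlt => inv_anti₀ (hP v i) hlt.le) ?_
  filter_upwards [hexp] with v hv i hi j hij hlt
  have hgrow : (1 + κ) * ‖edgeValue φ v i‖ ≤ ‖edgeValue φ (v * gen i) j‖ := by
    rw [edgeValue_child h0 v hij, mul_right_comm, norm_mul]
    gcongr
    exact (hv i hi j hij).growth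
  refine ⟨by nlinarith [hP v i], ?_⟩
  rw [← mul_inv]
  exact inv_anti₀ (mul_pos (by linarith) (hP v i)) hgrow

end FarEdges

section EdgeWeight

variable {φ : X n → ℂ} {κ : ℝ}

theorem exists_le_norm_hatSubtree (h0 : ∀ v i, φ (hatSubtree v i) ≠ 0)
    (hfar : ∀ᶠ v in cofinite, ∀ i ∈ outward v, 1 ≤ ‖φ (hatSubtree (v * gen i) i)‖) :
    ∃ c > 0, c ≤ 1 ∧ ∀ v k, c ≤ ‖φ (hatSubtree v k)‖ := by
  obtain ⟨L, hL⟩ := eventually_cofinite_iff.mp hfar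
  obtain ⟨c, ⟨hball, hc1⟩, hc⟩ : ∃ c : ℝ,
      ((∀ v ∈ ball n (L + 1), ∀ k, c ≤ ‖φ (hatSubtree v k)‖) ∧ c ≤ 1) ∧ 0 < c := by
    have hsmall {b : ℝ} (hb : 0 < b) : ∀ᶠ c in 𝓝[>] (0 : ℝ), c ≤ b :=
      eventually_nhdsWithin_of_eventually_nhds (eventually_le_nhds hb)
    exact (((eventually_all_finset _).mpr fun v _ => eventually_all.mpr fun k =>
      hsmall (norm_pos_iff.mpr (h0 v k))).and (hsmall one_pos)).and self_mem_nhdsWithin |>.exists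
  refine ⟨c, hc, hc1, fun v => ?_⟩
  induction v using len_induction with
  | one => exact hball 1 (mem_ball.mpr (by rw [len_one]; exact L.succ_pos))
  | mul_gen v i hi ih =>
    intro k
    rcases eq_or_ne i k with rfl | hik
    · rcases lt_or_ge (len v) L with hlt | hge
      · exact hball _ (mem_ball.mpr (by rw [len_mul_gen hi]; omega)) i
      · exact hc1.trans (hL v hge i hi)
    · rw [hatSubtree_mul_gen v hik]
      exact ih k

theorem pow_le_norm_prod {c : ℝ} (hc : 0 < c) (hc1 : c ≤ 1)
    (hlow : ∀ v k, c ≤ ‖φ (hatSubtree v k)‖) (v : Gamma n) (s : Finset (Fin n)) :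
    c ^ n ≤ ‖∏ k ∈ s, φ (hatSubtree v k)‖ := by
  rw [norm_prod]
  calc c ^ n ≤ c ^ s.card := pow_le_pow_of_le_one hc.le hc1 (by simpa using s.card_le_univ)
    _ = ∏ _k ∈ s, c := (Finset.prod_const c).symm
    _ ≤ ∏ k ∈ s, ‖φ (hatSubtree v k)‖ := Finset.prod_le_prod (fun _ _ => hc.le) fun k _ => hlow v k

theorem exists_le_norm_prod (hφ : φ ∈ bowditchSet n) (hn : 3 ≤ n) :
    ∃ c > 0, ∀ v (s : Finset (Fin n)), c ≤ ‖∏ k ∈ s, φ (hatSubtree v k)‖ := by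
  have h0 := hatSubtree_ne_zero hφ hn
  obtain ⟨κ, -, hexp⟩ := exists_eventually_isExpanding hφ hn
  obtain ⟨c, hc, hc1, hlow⟩ := exists_le_norm_hatSubtree h0 (by
    filter_upwards [hexp, eventually_le_norm_edgeValue hφ hn two_pos] with v hv hP i hi
    obtain ⟨j, hji, -⟩ := exists_ne_ne hn i i
    rw [← edgeRatio_mul_edgeValue h0, edgeValue_mul_gen, norm_mul]
    nlinarith [(hv i hi j hji.symm).half, hP i hi])
  exact ⟨c ^ n, pow_pos hc n, pow_le_norm_prod hc hc1 hlow⟩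

theorem sum_le_nat_mul {s : Finset (Fin n)} {f : Fin n → ℝ} {b : ℝ} (hb : 0 ≤ b)
    (hf : ∀ j ∈ s, f j ≤ b) : ∑ j ∈ s, f j ≤ n * b := by
  refine (Finset.sum_le_card_nsmul s f b hf).trans ?_
  rw [nsmul_eq_mul]
  gcongr
  exact s.card_le_univ.trans_eq (Fintype.card_fin n)

theorem geodesicValue_mul_geodesicValue (v : Gamma n) {i j k : Fin n} (hik : i ≠ k) (hjk : j ≠ k) :
    geodesicValue φ v i j * geodesicValue φ v i k =
      edgeValue φ v i * ∏ l ∈ ({i, j, k} : Finset (Fin n))ᶜ, φ (hatSubtree v l) := by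
  have hcompl : ({i, j, k} : Finset (Fin n))ᶜ = ({i, j} : Finset (Fin n))ᶜ.erase k := by
    ext l
    simp only [Finset.mem_compl, Finset.mem_insert, Finset.mem_singleton, Finset.mem_erase]
    tauto
  rw [← mul_geodesicValue v hik, hcompl, geodesicValue,
    ← Finset.mul_prod_erase _ (fun l => φ (hatSubtree v l))
      (show k ∈ ({i, j} : Finset (Fin n))ᶜ by simp [hik.symm, hjk.symm])]
  ring

theorem exists_forall_ne_inv_sq_le {c ε : ℝ} (hn : 3 ≤ n)
    (hprod : ∀ v (s : Finset (Fin n)), c ≤ ‖∏ k ∈ s, φ (hatSubtree v k)‖)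
    {v : Gamma n} {i : Fin n} (hε : 0 < ε) (hP : ε⁻¹ ≤ ‖edgeValue φ v i‖ * c) :
    ∃ j₀, i ≠ j₀ ∧ ∀ j, i ≠ j → j ≠ j₀ → (‖geodesicValue φ v i j‖ ^ 2)⁻¹ ≤ ε := by
  obtain ⟨j₁, hj₁, -⟩ := exists_ne_ne hn i i
  obtain ⟨j₀, hj₀, hmin⟩ := Finset.exists_min_image (univ.erase i)
    (fun j => ‖geodesicValue φ v i j‖) ⟨j₁, by simp [hj₁]⟩
  have hij₀ : i ≠ j₀ := (Finset.ne_of_mem_erase hj₀).symm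
  refine ⟨j₀, hij₀, fun j hij hj => inv_le_of_inv_le₀ hε ?_⟩
  calc ε⁻¹ ≤ ‖edgeValue φ v i‖ * c := hP
    _ ≤ ‖edgeValue φ v i‖ * ‖∏ l ∈ ({i, j, j₀} : Finset (Fin n))ᶜ, φ (hatSubtree v l)‖ := by
        gcongr
        exact hprod v _
    _ = ‖geodesicValue φ v i j‖ * ‖geodesicValue φ v i j₀‖ := by
        rw [← norm_mul, ← norm_mul, geodesicValue_mul_geodesicValue v hij₀ hj]
    _ ≤ ‖geodesicValue φ v i j‖ * ‖geodesicValue φ v i j‖ := by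
        gcongr
        exact hmin j (by simp [hij.symm])
    _ = ‖geodesicValue φ v i j‖ ^ 2 := (pow_two _).symm

/-- The weight of an edge, to which all terms of the identity beyond the edge compare. -/
def edgeWeight (φ : X n → ℂ) (v : Gamma n) (i : Fin n) : ℝ := (‖edgeValue φ v i‖ ^ 2)⁻¹

theorem edgeWeight_nonneg (v : Gamma n) (i : Fin n) : 0 ≤ edgeWeight φ v i := by
  unfold edgeWeight
  positivity

theorem edgeWeight_child (h0 : ∀ v i, φ (hatSubtree v i) ≠ 0) (v : Gamma n) {i j : Fin n}
    (hij : i ≠ j) : edgeWeight φ (v * gen i) j =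
      (‖edgeRatio φ (v * gen i) i * geodesicValue φ v i j‖ ^ 2)⁻¹ * edgeWeight φ v i := by
  rw [edgeWeight, edgeValue_child h0 v hij, mul_right_comm, norm_mul, mul_pow, mul_inv, edgeWeight]

theorem sum_edgeWeight_child_le (h0 : ∀ v i, φ (hatSubtree v i) ≠ 0) {v : Gamma n} {i j₀ : Fin n}
    {ε : ℝ} (hκ : 0 < κ) (hε : 0 ≤ ε)
    (hexp : ∀ j, i ≠ j → IsExpanding κ (geodesicValue φ v i j) (edgeRatio φ (v * gen i) i))
    (hij₀ : i ≠ j₀) (hj₀ : ∀ j, i ≠ j → j ≠ j₀ → (‖geodesicValue φ v i j‖ ^ 2)⁻¹ ≤ ε) :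
    ∑ j ∈ univ.erase i, edgeWeight φ (v * gen i) j ≤
      (((1 + κ) ^ 2)⁻¹ + n * (4 * ε)) * edgeWeight φ v i := by
  have hz (j) : 0 < ‖geodesicValue φ v i j‖ := norm_pos_iff.mpr (geodesicValue_ne_zero h0 v i j)
  have hmain : edgeWeight φ (v * gen i) j₀ ≤ ((1 + κ) ^ 2)⁻¹ * edgeWeight φ v i := by
    rw [edgeWeight_child h0 v hij₀]
    gcongr
    · exact edgeWeight_nonneg v i
    · exact (hexp j₀ hij₀).growth
  have hrest : ∀ j ∈ (univ.erase i).erase j₀,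
      edgeWeight φ (v * gen i) j ≤ 4 * ε * edgeWeight φ v i := by
    intro j hj
    simp only [Finset.mem_erase] at hj
    have hij : i ≠ j := hj.2.1.symm
    rw [edgeWeight_child h0 v hij]
    refine mul_le_mul_of_nonneg_right ?_ (edgeWeight_nonneg v i)
    calc (‖edgeRatio φ (v * gen i) i * geodesicValue φ v i j‖ ^ 2)⁻¹
      _ ≤ ((1 / 2 * ‖geodesicValue φ v i j‖) ^ 2)⁻¹ := by
          have := hz j
          rw [norm_mul]
          gcongr
          exact (hexp j hij).half
      _ = 4 * (‖geodesicValue φ v i j‖ ^ 2)⁻¹ := by rw [mul_pow, mul_inv]; norm_num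
      _ ≤ 4 * ε := by gcongr; exact hj₀ j hij hj.1
  rw [← Finset.add_sum_erase (univ.erase i) _ (by simp [hij₀.symm] : j₀ ∈ univ.erase i), add_mul]
  refine add_le_add hmain ((sum_le_nat_mul ?_ hrest).trans_eq (mul_assoc _ _ _).symm)
  exact mul_nonneg (by linarith) (edgeWeight_nonneg v i)

theorem summable_edgeSum_edgeWeight (hφ : φ ∈ bowditchSet n) (hn : 3 ≤ n) :
    Summable (edgeSum (edgeWeight φ)) := by
  obtain ⟨κ, hκ, hexp⟩ := exists_eventually_isExpanding hφ hn
  obtain ⟨c, hc, hprod⟩ := exists_le_norm_prod hφ hn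
  have hq : ((1 + κ) ^ 2)⁻¹ < 1 := inv_lt_one_of_one_lt₀ (by nlinarith)
  obtain ⟨ε, hρ, hε⟩ : ∃ ε : ℝ, ((1 + κ) ^ 2)⁻¹ + n * (4 * ε) < 1 ∧ 0 < ε := by
    have hlim : Tendsto (fun ε : ℝ => ((1 + κ) ^ 2)⁻¹ + n * (4 * ε)) (𝓝[>] 0)
        (𝓝 (((1 + κ) ^ 2)⁻¹ + n * (4 * 0))) :=
      (Continuous.tendsto (by fun_prop) 0).mono_left nhdsWithin_le_nhds
    exact ((hlim.eventually_lt_const (by simpa using hq)).and self_mem_nhdsWithin).exists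
  refine summable_edgeSum edgeWeight_nonneg hρ ?_
  filter_upwards [hexp, eventually_le_norm_edgeValue hφ hn
    (show 0 < ε⁻¹ / c by positivity)] with v hv hP i hi
  obtain ⟨j₀, hij₀, hj₀⟩ :=
    exists_forall_ne_inv_sq_le hn hprod hε ((div_le_iff₀ hc).mp (hP i hi))
  exact sum_edgeWeight_child_le (hatSubtree_ne_zero hφ hn) hκ hε.le (hv i hi) hij₀ hj₀

end EdgeWeight

/-! ### Comparison of the edge ratios with sums over geodesics -/

section Comparison

variable {φ : X n → ℂ} {κ c : ℝ} {μ : ℂ}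

/-- Half the sum of `h` over the geodesics through the `i`-edge at `v`, which approximates
`edgeRatio` on edges far from `1`. -/
def edgeEta (φ : X n → ℂ) (v : Gamma n) (i : Fin n) : ℂ :=
  ∑ j ∈ univ.erase i, eta (geodesicValue φ v i j)

theorem edgeEta_mul_one_sub (v : Gamma n) (i : Fin n) :
    edgeEta φ v i * (1 - edgeEta φ v i) = ∑ j ∈ univ.erase i, 1 / geodesicValue φ v i j ^ 2 -
      ∑ j ∈ univ.erase i, ∑ k ∈ (univ.erase i).erase j,
        eta (geodesicValue φ v i j) * eta (geodesicValue φ v i k) := by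
  simp only [← eta_mul_one_sub, ← Finset.mul_sum]
  rw [← Finset.sum_sub_distrib, edgeEta, Finset.sum_mul]
  refine Finset.sum_congr rfl fun j hj => ?_
  rw [← Finset.add_sum_erase _ (fun k => eta (geodesicValue φ v i k)) hj]
  ring

theorem edgeRatio_mul_one_sub (h0 : ∀ v i, φ (hatSubtree v i) ≠ 0) (hμ : IsMuHurwitzMap μ φ)
    (v : Gamma n) (i : Fin n) :
    edgeRatio φ v i * (1 - edgeRatio φ v i) =
      ∑ j ∈ univ.erase i, 1 / geodesicValue φ v i j ^ 2 - μ / edgeValue φ v i ^ 2 := by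
  have hP := edgeValue_ne_zero h0 v i
  have hterm : ∀ j ∈ univ.erase i,
      1 / geodesicValue φ v i j ^ 2 = φ (hatSubtree v j) ^ 2 / edgeValue φ v i ^ 2 := by
    intro j hj
    have hz := geodesicValue_ne_zero h0 v i j
    have hx := h0 v j
    rw [← mul_geodesicValue v (Finset.ne_of_mem_erase hj).symm]
    field_simp
  have hvertex := hμ.2 v
  rw [← vertexValue_eq_prod, vertexValue_eq h0 v i, ← Finset.add_sum_erase _ _ (Finset.mem_univ i),
    ← edgeRatio_mul_edgeValue h0] at hvertex
  rw [Finset.sum_congr rfl hterm, ← Finset.sum_div, ← sub_div, eq_div_iff (pow_ne_zero 2 hP)]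
  linear_combination -hvertex

theorem norm_eta_mul_eta_le (hc : 0 < c)
    (hprod : ∀ v (s : Finset (Fin n)), c ≤ ‖∏ k ∈ s, φ (hatSubtree v k)‖)
    (h0 : ∀ v i, φ (hatSubtree v i) ≠ 0) (v : Gamma n) {i j k : Fin n} (hik : i ≠ k)
    (hjk : j ≠ k) :
    ‖eta (geodesicValue φ v i j) * eta (geodesicValue φ v i k)‖ ≤
      4 / c ^ 2 * edgeWeight φ v i := by
  have hP : 0 < ‖edgeValue φ v i‖ := norm_pos_iff.mpr (edgeValue_ne_zero h0 v i)
  calc ‖eta (geodesicValue φ v i j) * eta (geodesicValue φ v i k)‖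
    _ ≤ 2 * (‖geodesicValue φ v i j‖ ^ 2)⁻¹ * (2 * (‖geodesicValue φ v i k‖ ^ 2)⁻¹) := by
        rw [norm_mul]
        gcongr <;> exact norm_eta_le _
    _ = 4 * (‖geodesicValue φ v i j * geodesicValue φ v i k‖ ^ 2)⁻¹ := by
        rw [norm_mul, mul_pow, mul_inv]
        ring
    _ ≤ 4 * ((‖edgeValue φ v i‖ * c) ^ 2)⁻¹ := by
        rw [geodesicValue_mul_geodesicValue v hik hjk, norm_mul]
        gcongr
        exact hprod v _
    _ = 4 / c ^ 2 * edgeWeight φ v i := by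
        rw [edgeWeight, mul_pow, mul_inv]
        ring

theorem norm_sub_edgeEta_ge {ε : ℝ} {t : ℂ} {v : Gamma n} {i j₀ : Fin n} (hε : 0 ≤ ε)
    (hij₀ : i ≠ j₀) (hj₀ : ∀ j, i ≠ j → j ≠ j₀ → (‖geodesicValue φ v i j‖ ^ 2)⁻¹ ≤ ε)
    (ht : κ ≤ ‖t - eta (geodesicValue φ v i j₀)‖) :
    κ - n * (2 * ε) ≤ ‖t - edgeEta φ v i‖ := by
  have hrest : ‖∑ j ∈ (univ.erase i).erase j₀, eta (geodesicValue φ v i j)‖ ≤ n * (2 * ε) := by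
    refine (norm_sum_le _ _).trans (sum_le_nat_mul (by positivity) fun j hj => ?_)
    simp only [Finset.mem_erase] at hj
    exact (norm_eta_le _).trans (by gcongr; exact hj₀ j hj.2.1.symm hj.1)
  rw [edgeEta, ← Finset.add_sum_erase _ _ (by simp [hij₀.symm] : j₀ ∈ univ.erase i), ← sub_sub]
  linarith [norm_sub_norm_le (t - eta (geodesicValue φ v i j₀))
    (∑ j ∈ (univ.erase i).erase j₀, eta (geodesicValue φ v i j))]

theorem edgeRatio_sub_edgeEta_mul (h0 : ∀ v i, φ (hatSubtree v i) ≠ 0) (hμ : IsMuHurwitzMap μ φ)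
    (v : Gamma n) (i : Fin n) :
    (edgeRatio φ v i - edgeEta φ v i) * (edgeRatio φ (v * gen i) i - edgeEta φ v i) =
      ∑ j ∈ univ.erase i, ∑ k ∈ (univ.erase i).erase j,
        eta (geodesicValue φ v i j) * eta (geodesicValue φ v i k) - μ / edgeValue φ v i ^ 2 := by
  rw [eq_sub_of_add_eq' (edgeRatio_add_edgeRatio h0 hμ.1 v i)]
  linear_combination edgeRatio_mul_one_sub h0 hμ v i - edgeEta_mul_one_sub (φ := φ) v i

/-- The edge ratio `r` and `s = edgeEta` almost solve the same quadratic equation, and expansion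
keeps `r` away from the conjugate root `1 - s`. -/
theorem exists_norm_edgeRatio_sub_edgeEta_le (hφ : φ ∈ bowditchSetMu n μ) (hn : 3 ≤ n) :
    ∃ C : ℝ, ∀ᶠ v in cofinite, ∀ i ∈ outward v,
      ‖edgeRatio φ v i - edgeEta φ v i‖ ≤ C * edgeWeight φ v i := by
  have h0 := hatSubtree_ne_zero hφ.1 hn
  obtain ⟨κ, hκ, hexp⟩ := exists_eventually_isExpanding hφ.1 hn
  obtain ⟨c, hc, hprod⟩ := exists_le_norm_prod hφ.1 hn
  have : (0 : ℝ) < n := by exact_mod_cast (by omega : 0 < n)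
  set ε := κ / (4 * n) with hε
  have hε0 : 0 < ε := by positivity
  refine ⟨(n * (n * (4 / c ^ 2)) + ‖μ‖) / (κ / 2), ?_⟩
  filter_upwards [hexp, eventually_le_norm_edgeValue hφ.1 hn
    (show 0 < ε⁻¹ / c by positivity)] with v hv hP i hi
  have hw := edgeWeight_nonneg (φ := φ) v i
  obtain ⟨j₀, hij₀, hj₀⟩ :=
    exists_forall_ne_inv_sq_le hn hprod hε0 ((div_le_iff₀ hc).mp (hP i hi))
  have hfar : κ / 2 ≤ ‖edgeRatio φ (v * gen i) i - edgeEta φ v i‖ := by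
    refine le_of_eq_of_le ?_ (norm_sub_edgeEta_ge hε0.le hij₀ hj₀ (hv i hi j₀ hij₀).sep)
    rw [hε]
    field_simp
    ring
  have hnum : ‖(edgeRatio φ v i - edgeEta φ v i) * (edgeRatio φ (v * gen i) i - edgeEta φ v i)‖ ≤
      (n * (n * (4 / c ^ 2)) + ‖μ‖) * edgeWeight φ v i := by
    rw [edgeRatio_sub_edgeEta_mul h0 hφ.2, add_mul, mul_assoc (n : ℝ), mul_assoc (n : ℝ)]
    refine (norm_sub_le _ _).trans (add_le_add ?_ ?_)
    · refine (norm_sum_le _ _).trans (sum_le_nat_mul (by positivity) fun j _ => ?_)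
      refine (norm_sum_le _ _).trans (sum_le_nat_mul (by positivity) fun k hk => ?_)
      simp only [Finset.mem_erase] at hk
      exact norm_eta_mul_eta_le hc hprod h0 v hk.2.1.symm hk.1.symm
    · rw [norm_div, norm_pow, div_eq_mul_inv, edgeWeight]
  rw [div_mul_eq_mul_div, le_div_iff₀ (by positivity)]
  refine le_trans ?_ hnum
  rw [norm_mul]
  gcongr

theorem norm_inv_vertexValue_le (h0 : ∀ v i, φ (hatSubtree v i) ≠ 0) {v : Gamma n} {i : Fin n}
    (ht : 1 / 2 ≤ ‖edgeRatio φ (v * gen i) i‖) :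
    ‖(vertexValue φ (v * gen i))⁻¹‖ ≤ 2 * edgeWeight φ v i := by
  rw [vertexValue_eq h0 _ i, edgeValue_mul_gen, norm_inv, norm_mul, norm_pow, mul_inv, edgeWeight]
  gcongr
  exact (inv_anti₀ (by norm_num) ht).trans_eq (by norm_num)

theorem norm_h_prod_compl_le (hc : 0 < c)
    (hprod : ∀ v (s : Finset (Fin n)), c ≤ ‖∏ k ∈ s, φ (hatSubtree v k)‖)
    (h0 : ∀ v i, φ (hatSubtree v i) ≠ 0) {v : Gamma n} {i : Fin n}
    (ht : 1 / 2 ≤ ‖edgeRatio φ (v * gen i) i‖) {I : Finset (Fin n)} (hi : i ∉ I) :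
    ‖h (∏ k ∈ Iᶜ, φ (hatSubtree (v * gen i) k))‖ ≤ 16 / c ^ 2 * edgeWeight φ v i := by
  have hP : 0 < ‖edgeValue φ v i‖ := norm_pos_iff.mpr (edgeValue_ne_zero h0 v i)
  have hlow : 1 / 2 * ‖edgeValue φ v i‖ * c ≤ ‖∏ k ∈ Iᶜ, φ (hatSubtree (v * gen i) k)‖ := by
    rw [← Finset.mul_prod_erase _ _ (Finset.mem_compl.mpr hi), norm_mul,
      ← edgeRatio_mul_edgeValue h0, edgeValue_mul_gen, norm_mul]
    gcongr
    exact hprod _ _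
  calc ‖h (∏ k ∈ Iᶜ, φ (hatSubtree (v * gen i) k))‖
    _ = 2 * ‖eta (∏ k ∈ Iᶜ, φ (hatSubtree (v * gen i) k))‖ := by
        rw [eta, norm_div, Complex.norm_ofNat]
        ring
    _ ≤ 2 * (2 * ((1 / 2 * ‖edgeValue φ v i‖ * c) ^ 2)⁻¹) := by
        gcongr
        exact (norm_eta_le _).trans (by gcongr)
    _ = 16 / c ^ 2 * edgeWeight φ v i := by
        rw [edgeWeight, mul_pow, mul_pow, mul_inv, mul_inv]
        ring

end Comparison

/-! ### The identity -/

section Identity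

variable {φ : X n → ℂ} {μ : ℂ}

/-- The contribution to the identity of the geodesics whose vertex closest to `1` is `v`. -/
def gateSum (φ : X n → ℂ) (v : Gamma n) : ℂ :=
  ∑ I ∈ powersetCard 2 (outward v), h (∏ k ∈ Iᶜ, φ (hatSubtree v k))

theorem sum_sum_eta_geodesicValue (v : Gamma n) :
    ∑ i ∈ outward v, ∑ j ∈ (outward v).erase i, eta (geodesicValue φ v i j) = gateSum φ v := by
  refine (sum_sum_erase_pair _ fun I => eta (∏ k ∈ Iᶜ, φ (hatSubtree v k))).trans ?_
  rw [nsmul_eq_mul, Finset.mul_sum, gateSum]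
  exact Finset.sum_congr rfl fun I _ => mul_div_cancel₀ _ two_ne_zero

theorem sum_edgeEta_one : ∑ i, edgeEta φ 1 i = gateSum φ 1 := by
  rw [← sum_sum_eta_geodesicValue, outward_one]
  rfl

theorem sum_edgeEta_child {v : Gamma n} {i : Fin n} (hi : i ∈ outward v) :
    ∑ j ∈ univ.erase i, edgeEta φ (v * gen i) j =
      edgeEta φ v i + gateSum φ (v * gen i) := by
  rw [← sum_sum_eta_geodesicValue, outward_mul_gen hi, edgeEta, ← Finset.sum_add_distrib]
  refine Finset.sum_congr rfl fun j hj => ?_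
  rw [edgeEta, ← Finset.add_sum_erase (univ.erase j) _
    (by simp [(Finset.ne_of_mem_erase hj).symm] : i ∈ univ.erase j), geodesicValue_comm,
    geodesicValue_mul_gen, Finset.erase_right_comm]

theorem sum_edgeRatio (h0 : ∀ v i, φ (hatSubtree v i) ≠ 0) (hμ : IsMuHurwitzMap μ φ)
    (v : Gamma n) : ∑ i, edgeRatio φ v i = 1 + μ / vertexValue φ v := by
  have hV : vertexValue φ v ≠ 0 := by
    rw [vertexValue_eq_prod]
    exact Finset.prod_ne_zero_iff.mpr fun i _ => h0 v i
  have hterm (i) : edgeRatio φ v i = φ (hatSubtree v i) ^ 2 / vertexValue φ v := by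
    rw [edgeRatio, ← mul_edgeValue v i, pow_two, mul_div_mul_left _ _ (h0 v i)]
  rw [Finset.sum_congr rfl fun i _ => hterm i, ← Finset.sum_div, ← hμ.2 v, ← vertexValue_eq_prod,
    one_add_div hV, add_sub_cancel]

theorem sum_edgeRatio_child (h0 : ∀ v i, φ (hatSubtree v i) ≠ 0) (hμ : IsMuHurwitzMap μ φ)
    (v : Gamma n) (i : Fin n) :
    ∑ j ∈ univ.erase i, edgeRatio φ (v * gen i) j =
      edgeRatio φ v i + μ / vertexValue φ (v * gen i) := by
  have hsum := sum_edgeRatio h0 hμ (v * gen i)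
  rw [← Finset.add_sum_erase _ _ (Finset.mem_univ i)] at hsum
  linear_combination hsum - edgeRatio_add_edgeRatio h0 hμ.1 v i

theorem tendsto_edgeSum_edgeRatio_sub_edgeEta (hφ : φ ∈ bowditchSetMu n μ) (hn : 3 ≤ n) :
    Tendsto (edgeSum fun v i => edgeRatio φ v i - edgeEta φ v i) atTop (𝓝 0) :=
  have ⟨_, hC⟩ := exists_norm_edgeRatio_sub_edgeEta_le hφ hn
  tendsto_edgeSum_zero (summable_edgeSum_edgeWeight hφ.1 hn) hC

theorem one_add_tsum_eq_zero (hφ : φ ∈ bowditchSetMu n μ) (hn : 3 ≤ n)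
    (hsum : Summable fun v => μ / vertexValue φ v - gateSum φ v) :
    1 + ∑' v, (μ / vertexValue φ v - gateSum φ v) = 0 := by
  have h0 := hatSubtree_ne_zero hφ.1 hn
  refine add_tsum_eq_zero ?_ (fun v i hi => ?_) (tendsto_edgeSum_edgeRatio_sub_edgeEta hφ hn) hsum
  · rw [Finset.sum_sub_distrib, sum_edgeRatio h0 hφ.2, sum_edgeEta_one, add_sub_assoc]
  · rw [Finset.sum_sub_distrib, sum_edgeRatio_child h0 hφ.2, sum_edgeEta_child hi,
      add_sub_add_comm]

theorem summable_norm_div_vertexValue (hφ : φ ∈ bowditchSet n) (hn : 3 ≤ n) (μ : ℂ) :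
    Summable fun v => ‖μ / vertexValue φ v‖ := by
  refine summable_of_le_edge (summable_edgeSum_edgeWeight hφ hn) (fun _ => norm_nonneg _)
    (C := ‖μ‖ * 2) ?_
  filter_upwards [eventually_half_le_norm_edgeRatio hφ hn] with v hv i hi
  rw [div_eq_mul_inv, norm_mul, mul_assoc]
  gcongr
  exact norm_inv_vertexValue_le (hatSubtree_ne_zero hφ hn) (hv i hi)

theorem summable_sum_norm_h (hφ : φ ∈ bowditchSet n) (hn : 3 ≤ n) :
    Summable fun v => ∑ I ∈ powersetCard 2 (outward v), ‖h (∏ k ∈ Iᶜ, φ (hatSubtree v k))‖ := by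
  obtain ⟨c, hc, hprod⟩ := exists_le_norm_prod hφ hn
  refine summable_of_le_edge (summable_edgeSum_edgeWeight hφ hn)
    (fun _ => Finset.sum_nonneg fun _ _ => norm_nonneg _)
    (C := (n - 1).choose 2 * (16 / c ^ 2)) ?_
  filter_upwards [eventually_half_le_norm_edgeRatio hφ hn] with v hv i hi
  rw [outward_mul_gen hi]
  refine (Finset.sum_le_card_nsmul _ _ (16 / c ^ 2 * edgeWeight φ v i) fun I hI => ?_).trans_eq ?_
  · refine norm_h_prod_compl_le hc hprod (hatSubtree_ne_zero hφ hn) (hv i hi) fun hiI => ?_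
    exact Finset.notMem_erase i univ ((Finset.mem_powersetCard.mp hI).1 hiI)
  · simp [mul_assoc]

theorem summable_norm_h_extend (hφ : φ ∈ bowditchSet n) (hn : 3 ≤ n) :
    Summable fun γ : A n => ‖h (extend φ γ)‖ := by
  rw [← (gateEquiv n 2).summable_iff, Function.comp_def,
    summable_sigma_of_nonneg fun _ => norm_nonneg _]
  refine ⟨fun v => Summable.of_finite, (summable_sum_norm_h hφ hn).congr fun v => ?_⟩
  rw [tsum_fintype, ← Finset.sum_coe_sort]
  rfl

theorem hasSum_gateSum (hφ : φ ∈ bowditchSet n) (hn : 3 ≤ n) :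
    HasSum (gateSum φ) (∑' γ : A n, h (extend φ γ)) := by
  have hsum := ((gateEquiv n 2).hasSum_iff.mpr (summable_norm_h_extend hφ hn).of_norm.hasSum)
  refine hsum.sigma fun v => ?_
  rw [gateSum, ← Finset.sum_coe_sort]
  exact hasSum_fintype _

end Identity

end

end MarkoffHurwitz

theorem theorem4p3 (n : ℕ) (hn : 3 ≤ n) (μ : ℂ) (φ : MarkoffHurwitz.X n → ℂ)
    (hφ : φ ∈ MarkoffHurwitz.bowditchSetMu n μ) :
    (Summable fun γ : MarkoffHurwitz.A n => ‖MarkoffHurwitz.h (MarkoffHurwitz.extend φ γ)‖) ∧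
    (Summable fun v : MarkoffHurwitz.Gamma n => ‖μ / MarkoffHurwitz.vertexValue φ v‖) ∧
    (∑' γ : MarkoffHurwitz.A n, MarkoffHurwitz.h (MarkoffHurwitz.extend φ γ)) -
        (∑' v : MarkoffHurwitz.Gamma n, μ / MarkoffHurwitz.vertexValue φ v) = 1 ∧
    (μ = 0 →
      (∑' γ : MarkoffHurwitz.A n,
        (1 - Complex.sqrt (1 - 4 / MarkoffHurwitz.extend φ γ ^ 2))) = 1) := by
  have hA := MarkoffHurwitz.summable_norm_h_extend hφ.1 hn
  have hV := MarkoffHurwitz.summable_norm_div_vertexValue hφ.1 hn μ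
  have hsource := hV.of_norm.hasSum.sub (MarkoffHurwitz.hasSum_gateSum hφ.1 hn)
  have hflux := MarkoffHurwitz.one_add_tsum_eq_zero hφ hn hsource.summable
  rw [hsource.tsum_eq] at hflux
  have hidentity : (∑' γ : MarkoffHurwitz.A n, MarkoffHurwitz.h (MarkoffHurwitz.extend φ γ)) -
      ∑' v : MarkoffHurwitz.Gamma n, μ / MarkoffHurwitz.vertexValue φ v = 1 := by
    linear_combination -hflux
  refine ⟨hA, hV, hidentity, ?_⟩
  rintro rfl
  simpa [MarkoffHurwitz.h] using hidentity
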